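/- Let $N\ge 2$ and $0\le k\le N$ be integers, let $\Omega=\mathbb{R}^{N,k}_+=\mathbb{R}^{N-k}\times(0,\infty)^k$ be the set of $x\in\mathbb{R}^N$ whose last $k$ coordinates are positive, and put $\lambda_{N,k}=\left(\frac{N-2}{2}+k\right)^2$. Let $\lambda\in(-\infty,\lambda_{N,k}]$, $m_\lambda=\sqrt{\lambda_{N,k}-\lambda}$, and $$\alpha_{k,\lambda}(x)=e^{-\frac{|x|^2}{8}}\,|x|^{m_\lambda-\frac{N-2}{2}}\,\frac{x_{N-k+1}x_{N-k+2}\cdots x_N}{|x|^k},\qquad x\in\Omega\setminus\{0\}.$$ All functions are real-valued and $L^2=L^2(\Omega)$. For $u,v\in C_c^\infty(\Omega)$ let $$l_\lambda(u,v)=\int_\Omega\left(\nabla u\cdot\nabla v-\frac{\lambda}{|x|^2}uv+\frac{|x|^2}{16}uv\right)dx,\qquad \|u\|_{l_\lambda}=\sqrt{l_\lambda(u,u)}.$$ (When $N=2$, $k=0$ and $\lambda<0$, only those $u\in C_c^\infty(\mathbb{R}^2)$ for which $\int |u|^2/|x|^2\,dx<\infty$, i.e. $u(0)=0$, are admitted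 here and below; in all other cases $l_\lambda$ is finite on all of $C_c^\infty(\Omega)$.) Let $H_\lambda$ be the closure of $C_c^\infty(\Omega)$ in the norm $\|\cdot\|_{l_\lambda}$, that is, the set of $u\in L^2$ for which there is a sequence in $C_c^\infty(\Omega)$ that is Cauchy in $\|\cdot\|_{l_\lambda}$ and converges to $u$ in $L^2$; the form $l_\lambda$ extends by continuity to $H_\lambda\times H_\lambda$. Let $L_\lambda=-\Delta-\frac{\lambda}{|x|^2}+\frac{|x|^2}{16}$ be the operator on $L^2$ associated with this form: $D(L_\lambda)$ is the set of $u\in H_\lambda$ for which there is $f\in L^2$ with $l_\lambda(u,v)=(f,v)_{L^2}$ for all $v\in H_\lambda$, and then $L_\lambda u=f$. Then the first (smallest) eigenvalue of $L_\lambda$ is $\frac{1+m_\lambda}{2}$. Moreover $\alpha_{k,\lambda}$ is a nonzero element of $L^2$, it belongs to $H_\lambda$ and to $D(L_\lambda)$, and the eigenspace $\{u\in D(L_\lambda): L_\lambda u=\frac{1+m_\lambda}{2}u\}$ is one-dimensional, spanned by $\alpha_{k,\lambda}$. -/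

import Mathlib

open MeasureTheory Filter Topology
open scoped ContDiff

noncomputable section

/-- Euclidean space `ℝ^N`. -/
abbrev EucN (N : ℕ) : Type := EuclideanSpace ℝ (Fin N)

/-- The corner space `ℝ^{N-k} × (0,∞)^k` (for `k ≤ N`): the last `k` coordinates are positive.
In zero-based indexing these are the coordinates `i` with `N - k ≤ i`. -/
def cornerSpace (N k : ℕ) : Set (EucN N) :=
  {x | ∀ i : Fin N, N ≤ (i : ℕ) + k → 0 < x i}

/-- Lebesgue measure on the corner space. -/
def cornerMeasure (N k : ℕ) : Measure (EucN N) :=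
  (volume : Measure (EucN N)).restrict (cornerSpace N k)

/-- The real Hilbert space `L²(ℝ^{N-k} × (0,∞)^k)`. -/
abbrev CornerL2 (N k : ℕ) : Type := Lp ℝ 2 (cornerMeasure N k)

/-- The Hardy constant `((N-2)/2 + k)²`. -/
def hardyConst (N k : ℕ) : ℝ := (((N : ℝ) - 2) / 2 + k) ^ 2

/-- `m_λ = √(λ_{N,k} - λ)`. -/
def mLam (N k : ℕ) (lam : ℝ) : ℝ := Real.sqrt (hardyConst N k - lam)

/-- `α_{k,λ}(x) = e^{-|x|²/8} |x|^{m_λ - (N-2)/2} x_{N-k+1} ⋯ x_N / |x|^k`. -/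
def alphaFun (N k : ℕ) (lam : ℝ) (x : EucN N) : ℝ :=
  Real.exp (-‖x‖ ^ 2 / 8) * ‖x‖ ^ (mLam N k lam - ((N : ℝ) - 2) / 2) *
    ((∏ i ∈ Finset.univ.filter (fun i : Fin N => N ≤ (i : ℕ) + k), x i) / ‖x‖ ^ k)

/-- The bilinear form
`l_λ(u,v) = ∫ (∇u·∇v - λ u v / |x|² + |x|² u v / 16) dx` on smooth functions. -/
def hardyForm (N k : ℕ) (lam : ℝ) (u v : EucN N → ℝ) : ℝ :=
  ∫ x, (inner ℝ (gradient u x) (gradient v x) - lam / ‖x‖ ^ 2 * (u x * v x)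
    + ‖x‖ ^ 2 / 16 * (u x * v x)) ∂(cornerMeasure N k)

/-- The form norm `‖u‖_{l_λ} = √(l_λ(u,u))`. -/
def hardyNorm (N k : ℕ) (lam : ℝ) (u : EucN N → ℝ) : ℝ :=
  Real.sqrt (hardyForm N k lam u u)

/-- The test functions: `u ∈ C_c^∞(ℝ^{N-k} × (0,∞)^k)` for which the integral `l_λ(u,u)` is
finite. The last clause follows from the others when `k ≥ 1`, or `N ≥ 3`, or `λ = 0`; it matters
only in the plane (`N = 2`, `k = 0`) with `λ < 0`, where it says `u(0) = 0`, and where the form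
would otherwise be infinite. -/
structure IsTestFun (N k : ℕ) (lam : ℝ) (u : EucN N → ℝ) : Prop where
  smooth : ContDiff ℝ ∞ u
  compact : HasCompactSupport u
  supp : tsupport u ⊆ cornerSpace N k
  finite : Integrable (fun x => lam / ‖x‖ ^ 2 * (u x * u x)) (cornerMeasure N k)

/-- `φ` is a sequence of test functions, Cauchy in the form norm and converging to `u` in `L²`. -/
structure FormApprox (N k : ℕ) (lam : ℝ) (u : CornerL2 N k) (φ : ℕ → EucN N → ℝ) : Prop where
  test : ∀ n, IsTestFun N k lam (φ n)
  cauchy : ∀ ε : ℝ, 0 < ε → ∃ n₀ : ℕ, ∀ m n : ℕ, n₀ ≤ m → n₀ ≤ n →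
    hardyNorm N k lam (φ m - φ n) < ε
  tendsto : Tendsto (fun n => eLpNorm (fun x => φ n x - u x) 2 (cornerMeasure N k)) atTop (𝓝 0)

/-- The form domain `H_λ`, the closure of the test functions in the form norm, realised in `L²`. -/
def formDomain (N k : ℕ) (lam : ℝ) : Set (CornerL2 N k) :=
  {u | ∃ φ, FormApprox N k lam u φ}

/-- `c` is the value `l_λ(u,v)` of the form extended by continuity to `H_λ × H_λ`. -/
def HasFormValue (N k : ℕ) (lam : ℝ) (u v : CornerL2 N k) (c : ℝ) : Prop :=
  u ∈ formDomain N k lam ∧ v ∈ formDomain N k lam ∧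
    ∀ φ ψ, FormApprox N k lam u φ → FormApprox N k lam v ψ →
      Tendsto (fun n => hardyForm N k lam (φ n) (ψ n)) atTop (𝓝 c)

/-- `u ∈ H_λ` and the functional `l_λ(u, ·)` on `H_λ` is represented by `f ∈ L²`. -/
def IsRepresentedBy (N k : ℕ) (lam : ℝ) (u f : CornerL2 N k) : Prop :=
  u ∈ formDomain N k lam ∧ ∀ v ∈ formDomain N k lam, HasFormValue N k lam u v (inner ℝ f v)

/-- The operator domain `D(L_λ) = {u ∈ H_λ : l_λ(u, ·) ∈ L²}`. -/
def opDomain (N k : ℕ) (lam : ℝ) : Set (CornerL2 N k) :=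
  {u | ∃ f, IsRepresentedBy N k lam u f}

/-- The operator `L_λ` associated with the form: `L_λ u` is the element of `L²` representing
`l_λ(u, ·)`. It is unique, see `isRepresentedBy_unique` below. -/
def hardyOp (N k : ℕ) (lam : ℝ) (u : opDomain N k lam) : CornerL2 N k :=
  u.2.choose

/-- The solutions `u ∈ D(L_λ)` of `L_λ u = μ u`. -/
def eigenspaceL (N k : ℕ) (lam μ : ℝ) : Set (CornerL2 N k) :=
  {u | ∃ h : u ∈ opDomain N k lam, hardyOp N k lam ⟨u, h⟩ = μ • u}

/-- The eigenvalues of `L_λ`. -/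
def eigenvaluesL (N k : ℕ) (lam : ℝ) : Set ℝ :=
  {μ | ∃ u ∈ eigenspaceL N k lam μ, u ≠ 0}

theorem isOpen_cornerSpace (N k : ℕ) : IsOpen (cornerSpace N k) := by
  have h : cornerSpace N k = ⋂ i : Fin N, {x : EucN N | N ≤ (i : ℕ) + k → 0 < x i} := by
    ext x; simp [cornerSpace]
  rw [h]
  refine isOpen_iInter_of_finite fun i => ?_
  by_cases hi : N ≤ (i : ℕ) + k
  · simp only [hi, forall_const]
    exact isOpen_lt continuous_const (by fun_prop)
  · simp [hi]

/-- Smooth functions with compact support in the corner space minus the origin are test functions. -/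
theorem isTestFun_of_supp (N k : ℕ) (lam : ℝ) (g : EucN N → ℝ) (hg : ContDiff ℝ ∞ g)
    (hc : HasCompactSupport g) (hs : tsupport g ⊆ cornerSpace N k \ {0}) :
    IsTestFun N k lam g := by
  refine ⟨hg, hc, fun x hx => (hs hx).1, ?_⟩
  have hcont : Continuous (fun x : EucN N => lam / ‖x‖ ^ 2 * (g x * g x)) := by
    rw [continuous_iff_continuousAt]
    intro x
    by_cases hx : x = 0
    · have h0 : x ∉ tsupport g := fun h => (hs h).2 hx
      have he : g =ᶠ[𝓝 x] 0 := notMem_tsupport_iff_eventuallyEq.mp h0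
      have h1 : (fun x : EucN N => lam / ‖x‖ ^ 2 * (g x * g x)) =ᶠ[𝓝 x] fun _ => 0 := by
        filter_upwards [he] with y hy
        simp [hy]
      exact continuousAt_const.congr h1.symm
    · have hgx : ContinuousAt g x := hg.continuous.continuousAt
      have hn : ‖x‖ ^ 2 ≠ 0 := by simpa using hx
      have h2 : ContinuousAt (fun x : EucN N => ‖x‖ ^ 2) x := by fun_prop
      exact (continuousAt_const.div h2 hn).mul (hgx.mul hgx)
  refine (hcont.integrable_of_hasCompactSupport ?_).restrict
  exact (hc.mul_left (f := g)).mul_left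

/-- A test function belongs to the form domain, as the limit of a constant sequence. -/
theorem formApprox_const (N k : ℕ) (lam : ℝ) (g : EucN N → ℝ) (hg : IsTestFun N k lam g)
    (hm : MemLp g 2 (cornerMeasure N k)) : FormApprox N k lam (hm.toLp g) (fun _ => g) := by
  refine ⟨fun _ => hg, fun ε hε => ⟨0, fun m n _ _ => ?_⟩, ?_⟩
  · have h0 : hardyNorm N k lam (g - g) = 0 := by
      have hz : ∀ x : EucN N, gradient (0 : EucN N → ℝ) x = 0 := fun x =>
        gradient_fun_const x (0 : ℝ)
      simp [hardyNorm, hardyForm, hz]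
    rw [h0]; exact hε
  · have h0 : eLpNorm (fun x => g x - (hm.toLp g) x) 2 (cornerMeasure N k) = 0 := by
      rw [eLpNorm_congr_ae (g := fun _ => (0 : ℝ))]
      · simp
      · filter_upwards [hm.coeFn_toLp] with x hx
        simp [hx]
    simp only [h0]
    exact tendsto_const_nhds

/-- The representing element is unique, so that `L_λ` is well defined. -/
theorem isRepresentedBy_unique (N k : ℕ) (hN : 0 < N) (lam : ℝ) (u f g : CornerL2 N k)
    (hf : IsRepresentedBy N k lam u f) (hg : IsRepresentedBy N k lam u g) : f = g := by
  have : Nonempty (Fin N) := ⟨⟨0, hN⟩⟩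
  obtain ⟨φ, hφ⟩ := hf.1
  have hopen : IsOpen (cornerSpace N k \ {(0 : EucN N)}) :=
    (isOpen_cornerSpace N k).sdiff isClosed_singleton
  have hmeas : MeasurableSet (cornerSpace N k) := (isOpen_cornerSpace N k).measurableSet
  have : IsLocallyFiniteMeasure (cornerMeasure N k) := by
    unfold cornerMeasure; infer_instance
  have hloc : LocallyIntegrable (⇑(f - g)) (cornerMeasure N k) :=
    (Lp.memLp (f - g)).locallyIntegrable (by norm_num)
  have key := hopen.ae_eq_zero_of_integral_contDiff_smul_eq_zero (μ := cornerMeasure N k)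
    (hloc.locallyIntegrableOn _) ?_
  · rw [← sub_eq_zero]
    apply Lp.ext
    have h1 : ∀ᵐ x ∂(cornerMeasure N k), x ∈ cornerSpace N k := ae_restrict_mem hmeas
    have h2 : ∀ᵐ x ∂(cornerMeasure N k), x ≠ 0 :=
      ae_restrict_of_ae (by simp [ae_iff])
    filter_upwards [key, h1, h2, Lp.coeFn_zero ℝ 2 (cornerMeasure N k)] with x hx hx1 hx2 hx3
    rw [hx3]
    exact hx ⟨hx1, hx2⟩
  · intro ψ hψ hc hs
    have ht := isTestFun_of_supp N k lam ψ hψ hc hs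
    have hm : MemLp ψ 2 (cornerMeasure N k) :=
      (hψ.continuous.memLp_of_hasCompactSupport hc).restrict _
    have ha := formApprox_const N k lam ψ ht hm
    have hv : hm.toLp ψ ∈ formDomain N k lam := ⟨_, ha⟩
    have e1 := (hf.2 _ hv).2.2 φ _ hφ ha
    have e2 := (hg.2 _ hv).2.2 φ _ hφ ha
    have e : inner ℝ (f - g) (hm.toLp ψ) = (0 : ℝ) := by
      rw [inner_sub_left, tendsto_nhds_unique e1 e2, sub_self]
    rw [L2.inner_def] at e
    rw [← e]
    refine integral_congr_ae ?_
    filter_upwards [hm.coeFn_toLp] with x hx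
    simp [hx]

theorem hardyOp_eq_iff (N k : ℕ) (hN : 0 < N) (lam : ℝ) (u : opDomain N k lam)
    (f : CornerL2 N k) : hardyOp N k lam u = f ↔ IsRepresentedBy N k lam u f :=
  ⟨fun h => h ▸ u.2.choose_spec,
    fun h => isRepresentedBy_unique N k hN lam u _ _ u.2.choose_spec h⟩

end

/-! The mechanism is the ground state representation. Put s = m_λ - (N-2)/2 - k, E = (1+m_λ)/2 and g
= ∇α/α = -x/4 + s x/|x|² + Σ e_i/x_i, the sum running over the face coordinates (`logGrad`). Since
s² + (N-2+2k)s = -λ, the field satisfies the Riccati equation div g + |g|² = |x|²/16 - λ/|x|² - E.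
With Dφ = ∇φ - gφ (`twistedGrad`) and the integral of div(φψ g) equal to zero, this gives l_λ(φ,ψ) =
E(φ,ψ) + Σ (D_i φ, D_i ψ) on test functions (`IsTestFun.hardyForm_eq`).

Convergence in the form sense is therefore L² convergence of the functions and of their twisted
gradients. Testing an eigenvalue equation with u itself gives Σ‖V_i‖² = (c-E)‖u‖², where V_i is the
limit of D_i φ_n. So every eigenvalue is at least E, and c = E forces Du = 0 weakly. Then u/α has
zero weak gradient on Ω∖{0}, which is connected because N ≥ 2, and u is a multiple of α
(`TwistedGradZero.eq_smul_alpha`). Conversely, multiples of α satisfy Du = 0 weakly, so they are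
eigenfunctions once they lie in H_λ.

What remains is α ∈ H_λ (`alpha_mem_formDomain`). As D(αη) = α∇η, it suffices to find cutoffs η → 1
with ∫ α²|∇η|² → 0. At a face α/x_i stays square integrable away from the origin, so dominated
convergence works. At the origin a logarithmic cutoff is used: even for m_λ = 0, when α²/|x|² is
only bounded by |x|^(-N), its cost is (n+1)^(-2) times O(n+1). -/

noncomputable section

/-! ### Coordinate partial derivatives. -/

/-- The partial derivative in the direction of the `i`-th coordinate. -/
def pderiv {N : ℕ} (i : Fin N) (f : EucN N → ℝ) (x : EucN N) : ℝ :=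
  fderiv ℝ f x (EuclideanSpace.single i 1)

section Pderiv

variable {N : ℕ} (i : Fin N) {f g : EucN N → ℝ} {x : EucN N}

theorem HasFDerivAt.pderiv_eq {f' : EucN N →L[ℝ] ℝ} (h : HasFDerivAt f f' x) :
    pderiv i f x = f' (EuclideanSpace.single i 1) := by
  rw [pderiv, h.fderiv]

theorem pderiv_sub (hf : DifferentiableAt ℝ f x) (hg : DifferentiableAt ℝ g x) :
    pderiv i (fun y => f y - g y) x = pderiv i f x - pderiv i g x := by
  rw [(hf.hasFDerivAt.fun_sub hg.hasFDerivAt).pderiv_eq]; rfl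

theorem pderiv_mul (hf : DifferentiableAt ℝ f x) (hg : DifferentiableAt ℝ g x) :
    pderiv i (fun y => f y * g y) x = pderiv i f x * g x + f x * pderiv i g x := by
  rw [(hf.hasFDerivAt.fun_mul hg.hasFDerivAt).pderiv_eq]
  simp [pderiv]; ring

theorem pderiv_exp (hf : DifferentiableAt ℝ f x) :
    pderiv i (fun y => Real.exp (f y)) x = Real.exp (f x) * pderiv i f x := by
  rw [hf.hasFDerivAt.exp.pderiv_eq]; rfl

theorem Filter.EventuallyEq.pderiv_eq (h : f =ᶠ[𝓝 x] g) : pderiv i f x = pderiv i g x := by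
  rw [pderiv, pderiv, h.fderiv_eq]

theorem pderiv_eq_zero_of_notMem_tsupport (h : x ∉ tsupport f) : pderiv i f x = 0 := by
  have he : f =ᶠ[𝓝 x] fun _ => 0 := notMem_tsupport_iff_eventuallyEq.mp h
  rw [he.pderiv_eq, pderiv]
  simp

theorem ContDiff.continuous_pderiv (h : ContDiff ℝ 1 f) : Continuous (pderiv i f) :=
  (h.continuous_fderiv one_ne_zero).clm_apply continuous_const

theorem ContDiff.pderiv_smooth (h : ContDiff ℝ ∞ f) : ContDiff ℝ ∞ (pderiv i f) := by
  have := h.fderiv_right (m := ∞) (by simp)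
  exact this.clm_apply contDiff_const

theorem tsupport_pderiv_subset : tsupport (pderiv i f) ⊆ tsupport f :=
  closure_minimal (fun x hx => by
    by_contra h
    exact hx (pderiv_eq_zero_of_notMem_tsupport i h)) (isClosed_tsupport f)

theorem HasCompactSupport.pderiv (h : HasCompactSupport f) : HasCompactSupport (pderiv i f) :=
  h.of_isClosed_subset (isClosed_tsupport _) (tsupport_pderiv_subset i)

theorem integral_pderiv_eq_zero (hf : ContDiff ℝ 1 f) (hc : HasCompactSupport f) :
    ∫ x, pderiv i f x = 0 := by
  have h := integral_mul_fderiv_eq_neg_fderiv_mul_of_integrable (μ := (volume : Measure (EucN N)))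
    (f := fun _ => (1 : ℝ)) (g := f) (v := EuclideanSpace.single i 1) ?_ ?_ ?_ ?_ ?_
  · simpa [_root_.pderiv] using h
  · simp
  · simp only [one_mul]
    exact (hf.continuous_pderiv i).integrable_of_hasCompactSupport (μ := volume) (hc.pderiv i)
  · simpa using hf.continuous.integrable_of_hasCompactSupport (μ := volume) hc
  · intro x _; fun_prop
  · intro x _; exact hf.differentiable one_ne_zero x

end Pderiv

/-! ### Functions with vanishing weak gradient. -/

theorem continuousLinearMap_eq_zero_of_single {N : ℕ} {L : EucN N →L[ℝ] ℝ}
    (h : ∀ i, L (EuclideanSpace.single i 1) = 0) : L = 0 := by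
  apply ContinuousLinearMap.coe_injective
  apply (EuclideanSpace.basisFun (Fin N) ℝ).toBasis.ext
  intro i
  simpa using h i

/-- A function with vanishing weak gradient is almost everywhere constant near each point. -/
theorem exists_ball_ae_const_of_weak_gradient_zero {N : ℕ} {U : Set (EucN N)} (hU : IsOpen U)
    {w : EucN N → ℝ} (hw : LocallyIntegrableOn w U)
    (h : ∀ ψ : EucN N → ℝ, ContDiff ℝ ∞ ψ → HasCompactSupport ψ → tsupport ψ ⊆ U →
      ∀ i, ∫ x, w x * pderiv i ψ x = 0) {x₀ : EucN N} (hx₀ : x₀ ∈ U) :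
    ∃ r > 0, Metric.ball x₀ r ⊆ U ∧ ∃ c : ℝ, ∀ᵐ x, x ∈ Metric.ball x₀ r → w x = c := by
  obtain ⟨R, hR, hRU⟩ := Metric.nhds_basis_closedBall.mem_iff.mp (hU.mem_nhds hx₀)
  -- Truncation makes `w` globally integrable. At points of the ball of radius R/2, mollifiers of
  -- radius at most R/2 do not see the truncation.
  set W : EucN N → ℝ := (Metric.closedBall x₀ R).indicator w with hW
  have hWint : Integrable W := (hw.integrableOn_compact_subset hRU
    (isCompact_closedBall x₀ R)).integrable_indicator Metric.isClosed_closedBall.measurableSet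
  have hWloc : LocallyIntegrable W := hWint.locallyIntegrable
  let φ : ℕ → ContDiffBump (0 : EucN N) := fun n =>
    ⟨R / 4 / (n + 1), R / 2 / (n + 1), by positivity, by gcongr; norm_num⟩
  have hφr : ∀ n, (φ n).rOut = R / 2 / (n + 1) := fun n => rfl
  have hφlim : Tendsto (fun n => (φ n).rOut) atTop (𝓝 0) := by
    simpa [hφr, div_eq_mul_inv] using
      (tendsto_one_div_add_atTop_nhds_zero_nat (𝕜 := ℝ)).const_mul (R / 2)
  have hae := ContDiffBump.ae_convolution_tendsto_right_of_locallyIntegrable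
    (μ := (volume : Measure (EucN N))) (K := 2) hφlim
    -- The ratio of outer to inner radius is exactly 2, the `K` required for convergence at Lebesgue
    -- points.
    (Eventually.of_forall fun n => by
      change R / 2 / (n + 1) ≤ 2 * (R / 4 / (n + 1)); apply le_of_eq; ring) hWloc
  let F : ℕ → EucN N → ℝ := fun n =>
    convolution ((φ n).normed volume) W (ContinuousLinearMap.lsmul ℝ ℝ) volume
  have hF : ∀ n, ∀ x ∈ Metric.ball x₀ (R / 2), HasFDerivAt (F n) (0 : EucN N →L[ℝ] ℝ) x := by
    intro n x hx
    have hsm : ContDiff ℝ ∞ ((φ n).normed volume) := (φ n).contDiff_normed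
    have hd := (φ n).hasCompactSupport_normed (μ := volume).hasFDerivAt_convolution_left
      (ContinuousLinearMap.lsmul ℝ ℝ) (hsm.of_le (by simp)) hWloc x
    suffices hz : convolution (fderiv ℝ ((φ n).normed volume)) W
        ((ContinuousLinearMap.lsmul ℝ ℝ).precompL (EucN N)) volume x = 0 by
      rwa [hz] at hd
    apply continuousLinearMap_eq_zero_of_single
    intro i
    have hc : ConvolutionExistsAt (fderiv ℝ ((φ n).normed volume)) W x
        ((ContinuousLinearMap.lsmul ℝ ℝ).precompL (EucN N)) volume :=
      ((φ n).hasCompactSupport_normed (μ := volume)).fderiv (𝕜 := ℝ) |>.convolutionExists_left _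
        (hsm.continuous_fderiv (by simp)) hWloc x
    rw [convolution_eq_swap, ContinuousLinearMap.integral_apply]
    swap
    · exact hc.integrable_swap
    -- The derivative of the mollification at x is, up to sign, the pairing of `w` with a partial
    -- derivative of this reflected bump, which is admissible because its support lies in the closed
    -- R-ball.
    let ψ : EucN N → ℝ := fun t => (φ n).normed volume (x - t)
    have hψs : ContDiff ℝ ∞ ψ := hsm.comp (contDiff_const.sub contDiff_id)
    have hψt : tsupport ψ ⊆ Metric.closedBall x (R / 2) := by
      refine closure_minimal (fun t ht => ?_) Metric.isClosed_closedBall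
      have : x - t ∈ Function.support ((φ n).normed volume) := ht
      rw [(φ n).support_normed_eq, mem_ball_zero_iff, hφr] at this
      rw [mem_closedBall_iff_norm']
      refine this.le.trans (div_le_self (by positivity) (by simp))
    have hball : Metric.closedBall x (R / 2) ⊆ Metric.closedBall x₀ R := by
      refine Metric.closedBall_subset_closedBall' ?_
      have := (Metric.mem_ball.mp hx).le
      linarith
    have hψc : HasCompactSupport ψ :=
      (isCompact_closedBall x (R / 2)).of_isClosed_subset (isClosed_tsupport _) hψt
    have h0 := h ψ hψs hψc ((hψt.trans hball).trans hRU) i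
    refine Eq.trans ?_ (neg_eq_zero.mpr h0)
    rw [← integral_neg]
    refine integral_congr_ae (Eventually.of_forall fun t => ?_)
    have hpd : pderiv i ψ t = - fderiv ℝ ((φ n).normed volume) (x - t)
        (EuclideanSpace.single i 1) := by
      have h1 : HasFDerivAt (fun t => x - t) (-ContinuousLinearMap.id ℝ (EucN N)) t :=
        (hasFDerivAt_id t).const_sub x
      have h2 := ((hsm.differentiable (by simp)) (x - t)).hasFDerivAt.comp t h1
      rw [show ψ = (φ n).normed volume ∘ fun t => x - t from rfl, h2.pderiv_eq]
      simp
    by_cases ht : t ∈ Metric.closedBall x₀ R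
    · simp [hW, ht, hpd, mul_comm]
    · have : pderiv i ψ t = 0 :=
        pderiv_eq_zero_of_notMem_tsupport i fun h' => ht (hball (hψt h'))
      simp [hW, ht, this]
  have hconst : ∀ n, ∀ x ∈ Metric.ball x₀ (R / 2), ∀ y ∈ Metric.ball x₀ (R / 2),
      F n x = F n y := fun n x hx y hy =>
    Metric.isOpen_ball.is_const_of_fderiv_eq_zero (𝕜 := ℝ)
      (convex_ball x₀ (R / 2)).isPreconnected
      (fun z hz => (hF n z hz).differentiableAt.differentiableWithinAt)
      (fun z hz => (hF n z hz).fderiv) hx hy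
  refine ⟨R / 2, by positivity, fun x hx => hRU ?_, ?_⟩
  · exact Metric.closedBall_subset_closedBall (by linarith) (Metric.ball_subset_closedBall hx)
  -- The points where mollification fails to converge form a null set, so the half ball contains a
  -- good point y; its value serves as the constant.
  · obtain ⟨y, hyb, hy⟩ : ∃ y ∈ Metric.ball x₀ (R / 2), Tendsto (fun n => F n y) atTop (𝓝 (W y)) := by
      by_contra! hcon
      have h1 : volume (Metric.ball x₀ (R / 2)) = 0 :=
        measure_mono_null (fun y hy => hcon y hy) (ae_iff.mp hae)
      exact (Metric.measure_ball_pos volume x₀ (by positivity)).ne' h1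
    refine ⟨W y, ?_⟩
    filter_upwards [hae] with x hx hxb
    have hx1 : W x = w x := Set.indicator_of_mem
      (Metric.closedBall_subset_closedBall (by linarith) (Metric.ball_subset_closedBall hxb)) _
    rw [← hx1]
    refine tendsto_nhds_unique hx (hy.congr fun n => hconst n y hyb x hxb)

/-- A function with vanishing weak gradient on a connected open set is almost everywhere
constant there. -/
theorem exists_ae_const_of_weak_gradient_zero {N : ℕ} {U : Set (EucN N)} (hU : IsOpen U)
    (hconn : IsPreconnected U) {w : EucN N → ℝ} (hw : LocallyIntegrableOn w U)
    (h : ∀ ψ : EucN N → ℝ, ContDiff ℝ ∞ ψ → HasCompactSupport ψ → tsupport ψ ⊆ U →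
      ∀ i, ∫ x, w x * pderiv i ψ x = 0) :
    ∃ c : ℝ, ∀ᵐ x, x ∈ U → w x = c := by
  have hloc := fun x (hx : x ∈ U) => exists_ball_ae_const_of_weak_gradient_zero hU hw h hx
  choose! r hr hrU c hc using hloc
  -- The function c is locally constant: if y is in the ball of x, the balls of x and y meet in
  -- positive measure, where `w` is almost everywhere both c x and c y.
  have hfd : ∀ x ∈ U, HasFDerivAt c (0 : EucN N →L[ℝ] ℝ) x := by
    intro x hx
    refine (hasFDerivAt_const (c x) x).congr_of_eventuallyEq ?_
    filter_upwards [Metric.ball_mem_nhds x (hr x hx)] with y hy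
    have hyU := hrU x hx hy
    have hne : (Metric.ball x (r x) ∩ Metric.ball y (r y)).Nonempty :=
      ⟨y, hy, Metric.mem_ball_self (hr y hyU)⟩
    have hpos := (Metric.isOpen_ball.inter Metric.isOpen_ball).measure_pos volume hne
    by_contra hcon
    refine hpos.ne' (measure_mono_null ?_
      (ae_iff.mp ((hc x hx).and (hc y hyU))))
    intro z hz hzz
    exact hcon ((hzz.2 hz.2).symm.trans (hzz.1 hz.1))
  obtain ⟨a, ha⟩ := hU.exists_is_const_of_fderiv_eq_zero hconn
    (fun x hx => (hfd x hx).differentiableAt.differentiableWithinAt) (fun x hx => (hfd x hx).fderiv)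
  refine ⟨a, ?_⟩
  rw [ae_iff]
  refine measure_null_of_locally_null _ fun x hx => ?_
  simp only [Classical.not_imp, Set.mem_ofPred_eq] at hx
  refine ⟨Metric.ball x (r x) ∩ {x | ¬(x ∈ U → w x = a)}, ?_, ?_⟩
  · exact inter_mem (mem_nhdsWithin_of_mem_nhds (Metric.ball_mem_nhds x (hr x hx.1)))
      self_mem_nhdsWithin
  · refine measure_mono_null ?_ (ae_iff.mp (hc x hx.1))
    rintro z ⟨hz, hz2⟩ hz3
    exact hz2 fun _ => (hz3 hz).trans (ha x hx.1)

/-! ### Coordinates, the squared norm and gradients. -/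

section Coordinates

variable {N : ℕ}

theorem hasFDerivAt_coord (j : Fin N) (x : EucN N) :
    HasFDerivAt (fun y : EucN N => y j) (EuclideanSpace.proj j : EucN N →L[ℝ] ℝ) x :=
  (EuclideanSpace.proj j : EucN N →L[ℝ] ℝ).hasFDerivAt

theorem contDiff_coord {n : WithTop ℕ∞} (j : Fin N) : ContDiff ℝ n (fun y : EucN N => y j) :=
  (EuclideanSpace.proj j : EucN N →L[ℝ] ℝ).contDiff

theorem pderiv_coord (i j : Fin N) (x : EucN N) :
    pderiv i (fun y : EucN N => y j) x = if i = j then 1 else 0 := by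
  rw [(hasFDerivAt_coord j x).pderiv_eq]
  simp [eq_comm]

theorem pderiv_norm_sq (i : Fin N) (x : EucN N) :
    pderiv i (fun y : EucN N => ‖y‖ ^ 2) x = 2 * x i := by
  rw [(hasStrictFDerivAt_norm_sq x).hasFDerivAt.pderiv_eq]
  simp [EuclideanSpace.inner_single_right]

theorem pderiv_comp {f : EucN N → ℝ} {g : ℝ → ℝ} (i : Fin N) {x : EucN N} {g' : ℝ}
    (hg : HasDerivAt g g' (f x)) (hf : DifferentiableAt ℝ f x) :
    pderiv i (fun y => g (f y)) x = g' * pderiv i f x := by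
  have h := hg.comp_hasFDerivAt x hf.hasFDerivAt
  exact h.pderiv_eq i

theorem abs_coord_le_norm (x : EucN N) (i : Fin N) : |x i| ≤ ‖x‖ := by
  simpa using PiLp.norm_apply_le x i

theorem sum_coord_sq (x : EucN N) : ∑ i, x i ^ 2 = ‖x‖ ^ 2 := by
  simp [EuclideanSpace.norm_sq_eq]

theorem inner_gradient_eq_sum (f g : EucN N → ℝ) (x : EucN N) :
    inner ℝ (gradient f x) (gradient g x) = ∑ i, pderiv i f x * pderiv i g x := by
  have h : ∀ (f : EucN N → ℝ) (i : Fin N), gradient f x i = pderiv i f x := by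
    intro f i
    have : inner ℝ (gradient f x) (EuclideanSpace.single i (1 : ℝ)) = pderiv i f x := by
      rw [gradient, InnerProductSpace.toDual_symm_apply, pderiv]
    rw [← this, EuclideanSpace.inner_single_right]
    simp
  rw [PiLp.inner_apply]
  exact Finset.sum_congr rfl fun i _ => by rw [h, h, mul_comm]; rfl

end Coordinates

/-! ### The divergence of x/|x|² across the origin. -/

/-- The field `x / |x|²` has distributional divergence `(N - 2) / |x|²` when tested against
functions vanishing suitably at the origin. -/
theorem integral_radial_divergence {N : ℕ} [Nonempty (Fin N)] {F : EucN N → ℝ}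
    (hF : ContDiff ℝ 1 F) (hc : HasCompactSupport F)
    (h0 : Integrable fun x => F x / ‖x‖ ^ 2)
    (h1 : ∀ i, Integrable fun x => pderiv i F x / ‖x‖) :
    Integrable (fun x => ∑ i, x i * pderiv i F x / ‖x‖ ^ 2 + ((N : ℝ) - 2) * F x / ‖x‖ ^ 2) ∧
    ∫ x, (∑ i, x i * pderiv i F x / ‖x‖ ^ 2 + ((N : ℝ) - 2) * F x / ‖x‖ ^ 2) = 0 := by
  set B : EucN N → ℝ := fun x => ∑ i, |pderiv i F x / ‖x‖| + ((N : ℝ) + 2) * |F x / ‖x‖ ^ 2|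
  have hB : Integrable B :=
    (integrable_finsetSum _ fun i _ => (h1 i).abs).add (h0.abs.const_mul _)
  have hDm : ∀ i, Continuous (pderiv i F) := fun i => hF.continuous_pderiv i
  have hx : ∀ᵐ x : EucN N, x ≠ 0 := by simp [ae_iff]
  -- H n is the divergence of F x/(|x|² + ε) with ε = 1/(n+1), a C¹ field even when F does not
  -- vanish near the origin, so its integral is zero. `B` dominates every H n, because with Q = |x|²
  -- + ε one has |N/Q - 2|x|²/Q²| ≤ (N+2)/|x|².
  let H : ℕ → EucN N → ℝ := fun n x =>
    ∑ i, x i * pderiv i F x / (‖x‖ ^ 2 + 1 / ((n : ℝ) + 1)) +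
      F x * (N / (‖x‖ ^ 2 + 1 / ((n : ℝ) + 1)) -
        2 * ‖x‖ ^ 2 / (‖x‖ ^ 2 + 1 / ((n : ℝ) + 1)) ^ 2)
  have hpos : ∀ (n : ℕ) (x : EucN N), 0 < ‖x‖ ^ 2 + 1 / ((n : ℝ) + 1) := fun n x => by positivity
  have hHint : ∀ n, ∫ x, H n x = 0 := by
    intro n
    set ε : ℝ := 1 / ((n : ℝ) + 1) with hε
    let g : Fin N → EucN N → ℝ := fun i x => F x * (x i * (‖x‖ ^ 2 + ε)⁻¹)
    have hs : ∀ i, ContDiff ℝ 1 (fun x : EucN N => x i * (‖x‖ ^ 2 + ε)⁻¹) := fun i =>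
      (contDiff_coord i).mul (((contDiff_norm_sq ℝ).add contDiff_const).inv
        fun x => (hpos n x).ne')
    have hg : ∀ i, ContDiff ℝ 1 (g i) := fun i => hF.mul (hs i)
    have hgc : ∀ i, HasCompactSupport (g i) := fun i => hc.mul_right
    have e : ∀ x, H n x = ∑ i, pderiv i (g i) x := by
      intro x
      have hd : ∀ i, pderiv i (g i) x = x i * pderiv i F x / (‖x‖ ^ 2 + ε) +
          F x * ((‖x‖ ^ 2 + ε)⁻¹ - 2 * x i ^ 2 / (‖x‖ ^ 2 + ε) ^ 2) := by
        intro i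
        have hne := (hpos n x).ne'
        have h3 : pderiv i (fun y : EucN N => (‖y‖ ^ 2 + ε)⁻¹) x =
            -((‖x‖ ^ 2 + ε) ^ 2)⁻¹ * (2 * x i) := by
          rw [← pderiv_norm_sq i x]
          refine pderiv_comp (f := fun y : EucN N => ‖y‖ ^ 2) (g := fun t => (t + ε)⁻¹) i ?_
            (hasStrictFDerivAt_norm_sq x).differentiableAt
          have := ((hasDerivAt_id (‖x‖ ^ 2)).add_const ε).inv hne
          simpa only [neg_div, one_div] using! this
        rw [pderiv_mul i (hF.differentiable one_ne_zero x) ((hs i).differentiable one_ne_zero x),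
          pderiv_mul i (hasFDerivAt_coord i x).differentiableAt, h3, pderiv_coord]
        · simp; field_simp; ring
        · exact (((hasStrictFDerivAt_norm_sq x).differentiableAt).add_const ε).inv hne
      have e1 : ∑ i, 2 * x i ^ 2 / (‖x‖ ^ 2 + ε) ^ 2 = 2 * ‖x‖ ^ 2 / (‖x‖ ^ 2 + ε) ^ 2 := by
        rw [← Finset.sum_div, ← Finset.mul_sum, sum_coord_sq]
      simp_rw [hd, Finset.sum_add_distrib, ← Finset.mul_sum, Finset.sum_sub_distrib, e1]
      simp [H, hε, div_eq_mul_inv]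
    simp_rw [e]
    rw [integral_finsetSum _ fun i _ =>
      ((hg i).continuous_pderiv i).integrable_of_hasCompactSupport ((hgc i).pderiv i)]
    exact Finset.sum_eq_zero fun i _ => integral_pderiv_eq_zero i (hg i) (hgc i)
  have hHm : ∀ n, Continuous (H n) := by
    intro n
    have hFc := hF.continuous
    have hq : ∀ x : EucN N, ‖x‖ ^ 2 + 1 / ((n : ℝ) + 1) ≠ 0 := fun x => (hpos n x).ne'
    have hq2 : ∀ x : EucN N, (‖x‖ ^ 2 + 1 / ((n : ℝ) + 1)) ^ 2 ≠ 0 :=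
      fun x => pow_ne_zero 2 (hq x)
    fun_prop (disch := assumption)
  have hbound : ∀ n, ∀ᵐ x : EucN N, ‖H n x‖ ≤ B x := by
    intro n
    filter_upwards [hx] with x hx
    have hr : 0 < ‖x‖ := norm_pos_iff.mpr hx
    set Q := ‖x‖ ^ 2 + 1 / ((n : ℝ) + 1) with hQ
    have hQp : 0 < Q := hpos n x
    have hle : ‖x‖ ^ 2 ≤ Q := le_add_of_nonneg_right (by positivity)
    have t1 : ∀ i, |x i * pderiv i F x / Q| ≤ |pderiv i F x / ‖x‖| := by
      intro i
      rw [abs_div, abs_div, abs_mul, abs_of_pos hQp, abs_of_pos hr, div_le_div_iff₀ hQp hr]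
      calc |x i| * |pderiv i F x| * ‖x‖ ≤ ‖x‖ * |pderiv i F x| * ‖x‖ := by
            gcongr; exact abs_coord_le_norm x i
        _ = |pderiv i F x| * ‖x‖ ^ 2 := by ring
        _ ≤ _ := by gcongr
    have t2 : |F x * (N / Q - 2 * ‖x‖ ^ 2 / Q ^ 2)| ≤ (N + 2) * |F x / ‖x‖ ^ 2| := by
      have hr2 : (0 : ℝ) < ‖x‖ ^ 2 := by positivity
      have a1 : (N : ℝ) / Q ≤ N / ‖x‖ ^ 2 := by gcongr
      have a2 : 2 * ‖x‖ ^ 2 / Q ^ 2 ≤ 2 / ‖x‖ ^ 2 := by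
        rw [div_le_div_iff₀ (by positivity) hr2]
        nlinarith
      have a3 : |(N : ℝ) / Q - 2 * ‖x‖ ^ 2 / Q ^ 2| ≤ (N + 2) / ‖x‖ ^ 2 := by
        rw [add_div, abs_le]
        have : 0 ≤ (N : ℝ) / Q := by positivity
        have : 0 ≤ 2 * ‖x‖ ^ 2 / Q ^ 2 := by positivity
        have : 0 ≤ (N : ℝ) / ‖x‖ ^ 2 := by positivity
        have : 0 ≤ 2 / ‖x‖ ^ 2 := by positivity
        constructor <;> linarith
      rw [abs_mul, abs_div, abs_of_pos hr2]
      calc _ ≤ |F x| * ((N + 2) / ‖x‖ ^ 2) := by gcongr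
        _ = _ := by ring
    rw [Real.norm_eq_abs]
    refine (abs_add_le _ _).trans (add_le_add ((Finset.abs_sum_le_sum_abs _ _).trans ?_) t2)
    exact Finset.sum_le_sum fun i _ => t1 i
  have hlim : ∀ᵐ x : EucN N, Tendsto (fun n => H n x) atTop
      (𝓝 (∑ i, x i * pderiv i F x / ‖x‖ ^ 2 + ((N : ℝ) - 2) * F x / ‖x‖ ^ 2)) := by
    filter_upwards [hx] with x hx
    have hr : ‖x‖ ^ 2 ≠ 0 := by simpa using hx
    have hQ : Tendsto (fun n : ℕ => ‖x‖ ^ 2 + 1 / ((n : ℝ) + 1)) atTop (𝓝 (‖x‖ ^ 2)) := by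
      simpa using (tendsto_const_nhds (x := ‖x‖ ^ 2)).add
        (tendsto_one_div_add_atTop_nhds_zero_nat (𝕜 := ℝ))
    have := (tendsto_finsetSum Finset.univ fun i _ =>
      (tendsto_const_nhds (x := x i * pderiv i F x)).div hQ hr).add
      (((tendsto_const_nhds (x := (N : ℝ))).div hQ hr |>.sub
        ((tendsto_const_nhds (x := 2 * ‖x‖ ^ 2)).div (hQ.pow 2) (pow_ne_zero 2 hr))).const_mul (F x))
    convert this using 2
    congr 1
    field_simp
  refine ⟨hB.mono' (by
      refine aestronglyMeasurable_of_tendsto_ae atTop (fun n => (hHm n).aestronglyMeasurable) hlim)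
    ?_, ?_⟩
  · filter_upwards [hlim, ae_all_iff.mpr hbound] with x h2 h3
    exact le_of_tendsto h2.norm (Eventually.of_forall h3)
  · have := tendsto_integral_of_dominated_convergence B
      (fun n => (hHm n).aestronglyMeasurable) hB hbound hlim
    simp only [hHint] at this
    exact tendsto_nhds_unique this tendsto_const_nhds

/-! ### The logarithmic gradient of the ground state and its Riccati identity. -/

/-- The indices of the coordinates that are positive on the corner space. -/
def faceIdx (N k : ℕ) : Finset (Fin N) :=
  Finset.univ.filter (fun i : Fin N => N ≤ (i : ℕ) + k)

/-- The exponent of `|x|` that multiplies the harmonic polynomial in the ground state. -/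
def radExp (N k : ℕ) (lam : ℝ) : ℝ := mLam N k lam - ((N : ℝ) - 2) / 2 - k

/-- The components of the logarithmic gradient of the ground state. -/
def logGrad (N k : ℕ) (lam : ℝ) (i : Fin N) (x : EucN N) : ℝ :=
  -(x i / 4) + radExp N k lam * (x i / ‖x‖ ^ 2) + if i ∈ faceIdx N k then (x i)⁻¹ else 0

/-- The components of `∇φ - φ ∇α / α`, where `α` is the ground state. -/
def twistedGrad (N k : ℕ) (lam : ℝ) (i : Fin N) (φ : EucN N → ℝ) (x : EucN N) : ℝ :=
  pderiv i φ x - logGrad N k lam i x * φ x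

/-- The lowest eigenvalue. -/
def groundEnergy (N k : ℕ) (lam : ℝ) : ℝ := (1 + mLam N k lam) / 2

section Algebra

variable {N k : ℕ} {lam : ℝ}

theorem mem_faceIdx {i : Fin N} : i ∈ faceIdx N k ↔ N ≤ (i : ℕ) + k := by simp [faceIdx]

theorem pos_of_mem_faceIdx {i : Fin N} (hi : i ∈ faceIdx N k) {x : EucN N}
    (hx : x ∈ cornerSpace N k) : 0 < x i := hx i (mem_faceIdx.mp hi)

theorem card_faceIdx (hk : k ≤ N) : (faceIdx N k).card = k := by
  have h : (faceIdx N k).map Fin.valEmbedding = Finset.Ico (N - k) N := by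
    ext a
    simp only [Finset.mem_map, mem_faceIdx, Fin.valEmbedding_apply, Finset.mem_Ico]
    constructor
    · rintro ⟨i, hi, rfl⟩
      have := i.2
      omega
    · rintro ⟨h1, h2⟩
      exact ⟨⟨a, h2⟩, by simp; omega, rfl⟩
  rw [← Finset.card_map Fin.valEmbedding, h, Nat.card_Ico]
  omega

theorem mLam_sq (hlam : lam ≤ hardyConst N k) :
    mLam N k lam ^ 2 = hardyConst N k - lam :=
  Real.sq_sqrt (sub_nonneg.mpr hlam)

theorem mLam_nonneg : 0 ≤ mLam N k lam := Real.sqrt_nonneg _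

theorem groundEnergy_pos : 0 < groundEnergy N k lam := by
  have := mLam_nonneg (N := N) (k := k) (lam := lam)
  unfold groundEnergy; linarith

/-- The indicial equation at the origin: completing the square turns it into (s + (N-2)/2 + k)² =
m_λ². It is what cancels all 1/|x|² terms in the ground state representation. -/
theorem radExp_mul (hlam : lam ≤ hardyConst N k) :
    radExp N k lam ^ 2 + 2 * radExp N k lam * k + radExp N k lam * (N - 2) = -lam := by
  have h := mLam_sq hlam
  unfold hardyConst at h
  unfold radExp
  linear_combination h

/-- For λ = 0 the singular part of g disappears. This matters in the plane with k = 0, where test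
functions need not vanish at 0 and φ/|x| may fail to be in L². The bound N ≥ 2 makes (N-2)/2 + k
nonnegative, hence equal to the square root of its square. -/
theorem radExp_eq_zero (hN : 2 ≤ N) (h0 : lam = 0) : radExp N k lam = 0 := by
  have hN' : (2 : ℝ) ≤ N := by exact_mod_cast hN
  have hk : (0 : ℝ) ≤ k := Nat.cast_nonneg k
  unfold radExp mLam hardyConst
  rw [h0, sub_zero, Real.sqrt_sq (by linarith)]
  ring

/-- The Riccati identity satisfied by the logarithmic gradient of the ground state. -/
theorem sum_logGrad_sq (hk : k ≤ N) {x : EucN N} (hx : x ∈ cornerSpace N k) (hx0 : x ≠ 0) :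
    ∑ i, logGrad N k lam i x ^ 2 = ‖x‖ ^ 2 / 16 + radExp N k lam ^ 2 / ‖x‖ ^ 2
      + (∑ i ∈ faceIdx N k, ((x i)⁻¹) ^ 2) - radExp N k lam / 2 - k / 2
      + 2 * radExp N k lam * k / ‖x‖ ^ 2 := by
  have hr : ‖x‖ ^ 2 ≠ 0 := by simpa using hx0
  set s := radExp N k lam
  set R := ‖x‖ ^ 2 with hR
  -- On a face coordinate the cross terms with 1/x_i are constant in x_i because x_i · (1/x_i) = 1;
  -- summed over the k faces they give the terms in k.
  have e : ∀ i, logGrad N k lam i x ^ 2 = (1 / 16 + s ^ 2 / R ^ 2 - s / (2 * R)) * x i ^ 2 +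
      (if i ∈ faceIdx N k then ((x i)⁻¹) ^ 2 - 1 / 2 + 2 * s / R else 0) := by
    intro i
    unfold logGrad
    split_ifs with hi
    · have := (pos_of_mem_faceIdx hi hx).ne'
      field_simp
      ring
    · field_simp
      ring
  simp_rw [e, Finset.sum_add_distrib, ← Finset.mul_sum, sum_coord_sq, ← hR,
    Finset.sum_ite_mem, Finset.univ_inter, Finset.sum_add_distrib, Finset.sum_sub_distrib,
    Finset.sum_const, card_faceIdx hk]
  simp only [nsmul_eq_mul]
  field_simp
  ring

end Algebra

/-! ### Integration over the corner space. -/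

section Support

variable {N k : ℕ} {lam : ℝ}

theorem measurableSet_cornerSpace (N k : ℕ) : MeasurableSet (cornerSpace N k) :=
  (isOpen_cornerSpace N k).measurableSet

theorem integral_corner_eq {f : EucN N → ℝ} (hf : Function.support f ⊆ cornerSpace N k) :
    ∫ x, f x ∂(cornerMeasure N k) = ∫ x, f x :=
  setIntegral_eq_integral_of_forall_compl_eq_zero fun _ hx =>
    Function.notMem_support.mp fun h => hx (hf h)

theorem integrable_corner_iff {f : EucN N → ℝ} (hf : Function.support f ⊆ cornerSpace N k) :
    Integrable f (cornerMeasure N k) ↔ Integrable f :=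
  integrableOn_iff_integrable_of_support_subset hf

theorem ae_corner_mem (N k : ℕ) [Nonempty (Fin N)] :
    ∀ᵐ x ∂(cornerMeasure N k), x ∈ cornerSpace N k \ {0} := by
  have h1 : ∀ᵐ x ∂(cornerMeasure N k), x ∈ cornerSpace N k :=
    ae_restrict_mem (measurableSet_cornerSpace N k)
  have h2 : ∀ᵐ x ∂(cornerMeasure N k), x ≠ 0 := ae_restrict_of_ae (by simp [ae_iff])
  filter_upwards [h1, h2] with x h1 h2 using ⟨h1, h2⟩

theorem integral_corner_pderiv_eq_zero (i : Fin N) {f : EucN N → ℝ} (hf : ContDiff ℝ 1 f)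
    (hc : HasCompactSupport f) (hs : tsupport f ⊆ cornerSpace N k) :
    Integrable (pderiv i f) (cornerMeasure N k) ∧ ∫ x, pderiv i f x ∂(cornerMeasure N k) = 0 := by
  constructor
  · exact ((hf.continuous_pderiv i).integrable_of_hasCompactSupport (hc.pderiv i)).restrict
  · rw [integral_corner_eq, integral_pderiv_eq_zero i hf hc]
    exact ((subset_tsupport _).trans (tsupport_pderiv_subset i)).trans hs

theorem contDiff_of_contDiffAt_tsupport {F : EucN N → ℝ} {n : WithTop ℕ∞}
    (h : ∀ x ∈ tsupport F, ContDiffAt ℝ n F x) : ContDiff ℝ n F := by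
  rw [contDiff_iff_contDiffAt]
  intro x
  by_cases hx : x ∈ tsupport F
  · exact h x hx
  · have he : F =ᶠ[𝓝 x] fun _ => 0 := notMem_tsupport_iff_eventuallyEq.mp hx
    exact contDiffAt_const.congr_of_eventuallyEq he

/-- On the support of F the coordinate is positive, and off the support the quotient vanishes
locally, so the singularity on the face is never met. -/
theorem contDiff_div_coord {F : EucN N → ℝ} {n : WithTop ℕ∞} (hF : ContDiff ℝ n F)
    (hs : tsupport F ⊆ cornerSpace N k) {i : Fin N} (hi : i ∈ faceIdx N k) :
    ContDiff ℝ n fun x => (x i)⁻¹ * F x := by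
  refine contDiff_of_contDiffAt_tsupport fun x hx => ?_
  have hx' : x ∈ tsupport F := tsupport_mul_subset_right hx
  exact ((contDiff_coord i).contDiffAt.inv (pos_of_mem_faceIdx hi (hs hx')).ne').mul
    hF.contDiffAt

end Support

/-! ### Test functions and the ground state representation. -/

namespace IsTestFun

variable {N k : ℕ} {lam : ℝ} {φ ψ : EucN N → ℝ}

theorem memLp (h : IsTestFun N k lam φ) : MemLp φ 2 (cornerMeasure N k) :=
  (h.smooth.continuous.memLp_of_hasCompactSupport h.compact).restrict _

theorem support_subset (h : IsTestFun N k lam φ) : Function.support φ ⊆ cornerSpace N k :=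
  (subset_tsupport φ).trans h.supp

theorem differentiableAt (h : IsTestFun N k lam φ) (x : EucN N) : DifferentiableAt ℝ φ x :=
  h.smooth.differentiable (by simp) x

theorem contDiff_one (h : IsTestFun N k lam φ) : ContDiff ℝ 1 φ := h.smooth.of_le (by simp)

theorem pderiv_memLp (h : IsTestFun N k lam φ) (i : Fin N) :
    MemLp (pderiv i φ) 2 (cornerMeasure N k) :=
  ((h.contDiff_one.continuous_pderiv i).memLp_of_hasCompactSupport (h.compact.pderiv i)).restrict _

/-- For λ ≠ 0 the finiteness clause can be divided by λ. This is the only source of integrability at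
the origin, and it covers every N ≥ 2 without a Hardy inequality. -/
theorem memLp_div_norm (h : IsTestFun N k lam φ) (h0 : lam ≠ 0) :
    MemLp (fun x => φ x / ‖x‖) 2 volume := by
  have hm : Measurable fun x => φ x / ‖x‖ := h.smooth.continuous.measurable.div measurable_norm
  rw [memLp_two_iff_integrable_sq hm.aestronglyMeasurable]
  have h1 := (integrable_corner_iff (fun x hx => h.support_subset fun h' => hx (by simp [h']))).mp
    (h.finite.const_mul lam⁻¹)
  refine h1.congr (Eventually.of_forall fun x => ?_)
  simp only
  field_simp

theorem sub (h : IsTestFun N k lam φ) (h' : IsTestFun N k lam ψ) : IsTestFun N k lam (φ - ψ) := by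
  refine ⟨h.smooth.sub h'.smooth, h.compact.sub h'.compact, ?_, ?_⟩
  · exact (tsupport_sub φ ψ).trans (Set.union_subset h.supp h'.supp)
  · by_cases h0 : lam = 0
    · simp [h0]
    · have h1 := ((h.memLp_div_norm h0).sub (h'.memLp_div_norm h0)).integrable_sq.const_mul lam
      refine (h1.restrict (s := cornerSpace N k)).congr (Eventually.of_forall fun x => ?_)
      simp only [Pi.sub_apply]
      field_simp

theorem radExp_smul_memLp (hN : 2 ≤ N) (h : IsTestFun N k lam φ) :
    MemLp (fun x => radExp N k lam * (φ x / ‖x‖)) 2 (cornerMeasure N k) := by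
  by_cases h0 : lam = 0
  · simp [radExp_eq_zero hN h0]
  · exact ((h.memLp_div_norm h0).restrict _).const_mul _

/-- Each part of gφ is square integrable separately: x_iφ and φ/x_i are continuous with compact
support, and the radial part is sφ/|x| times a factor bounded by 1. -/
theorem twistedGrad_memLp (hN : 2 ≤ N) (h : IsTestFun N k lam φ) (i : Fin N) :
    MemLp (twistedGrad N k lam i φ) 2 (cornerMeasure N k) := by
  have hc := h.smooth.continuous
  have h1 : MemLp (fun x => x i * φ x) 2 (cornerMeasure N k) :=
    (((contDiff_coord (n := 0) i).continuous.mul hc).memLp_of_hasCompactSupport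
      h.compact.mul_left).restrict _
  have h2 : MemLp (fun x => radExp N k lam * (φ x / ‖x‖) * (x i / ‖x‖)) 2 (cornerMeasure N k) := by
    refine (h.radExp_smul_memLp hN).mono ?_ (Eventually.of_forall fun x => ?_)
    · refine (h.radExp_smul_memLp hN).1.mul (Measurable.aestronglyMeasurable ?_)
      exact (contDiff_coord (n := 0) i).continuous.measurable.div measurable_norm
    · rw [norm_mul]
      refine mul_le_of_le_one_right (norm_nonneg _) ?_
      rw [norm_div, norm_norm, Real.norm_eq_abs]
      exact div_le_one_of_le₀ (abs_coord_le_norm x i) (norm_nonneg _)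
  have h3 : MemLp (fun x => if i ∈ faceIdx N k then (x i)⁻¹ * φ x else 0) 2
      (cornerMeasure N k) := by
    split_ifs with hi
    · exact ((contDiff_div_coord h.smooth h.supp hi).continuous.memLp_of_hasCompactSupport
        h.compact.mul_left).restrict _
    · simp
  have h4 := (h.pderiv_memLp i).add (((h1.const_mul (1 / 4)).sub h2).sub h3)
  refine h4.ae_eq (Eventually.of_forall fun x => ?_)
  simp only [Pi.add_apply, Pi.sub_apply, twistedGrad, logGrad]
  split_ifs <;> ring

/-- The ground state representation of the form. -/
theorem hardyForm_eq (hN : 2 ≤ N) (hk : k ≤ N) (hlam : lam ≤ hardyConst N k)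
    (hφ : IsTestFun N k lam φ) (hψ : IsTestFun N k lam ψ) :
    hardyForm N k lam φ ψ = groundEnergy N k lam * ∫ x, φ x * ψ x ∂(cornerMeasure N k) +
      ∑ i, ∫ x, twistedGrad N k lam i φ x * twistedGrad N k lam i ψ x ∂(cornerMeasure N k) := by
  have : Nonempty (Fin N) := ⟨⟨0, by omega⟩⟩
  set F : EucN N → ℝ := fun x => φ x * ψ x with hFdef
  have hF : ContDiff ℝ ∞ F := hφ.smooth.mul hψ.smooth
  have hF1 : ContDiff ℝ 1 F := hF.of_le (by simp)
  have hFc : HasCompactSupport F := hφ.compact.mul_right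
  have hFs : tsupport F ⊆ cornerSpace N k := (tsupport_mul_subset_left).trans hφ.supp
  have hDF : ∀ i x, pderiv i F x = pderiv i φ x * ψ x + φ x * pderiv i ψ x := fun i x =>
    pderiv_mul i (hφ.differentiableAt x) (hψ.differentiableAt x)
  have hA1 : Integrable F (cornerMeasure N k) := hφ.memLp.integrable_mul hψ.memLp
  have hA2 : ∀ i, Integrable (fun x => twistedGrad N k lam i φ x * twistedGrad N k lam i ψ x)
      (cornerMeasure N k) := fun i =>
    (hφ.twistedGrad_memLp hN i).integrable_mul (hψ.twistedGrad_memLp hN i)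
  -- The next three facts say that the three pieces of div(Fg), coming from -x/4, s x/|x|² and the
  -- e_i/x_i, integrate to zero.
  have hB1 : ∀ i, Integrable (pderiv i fun x => x i * F x) (cornerMeasure N k) ∧
      ∫ x, pderiv i (fun x => x i * F x) x ∂(cornerMeasure N k) = 0 := fun i =>
    integral_corner_pderiv_eq_zero i ((contDiff_coord i).mul hF1) hFc.mul_left
      (tsupport_mul_subset_right.trans hFs)
  have hB2 : ∀ i ∈ faceIdx N k, Integrable (pderiv i fun x => (x i)⁻¹ * F x) (cornerMeasure N k) ∧
      ∫ x, pderiv i (fun x => (x i)⁻¹ * F x) x ∂(cornerMeasure N k) = 0 := fun i hi =>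
    integral_corner_pderiv_eq_zero i (contDiff_div_coord hF1 hFs hi) hFc.mul_left
      (tsupport_mul_subset_right.trans hFs)
  let T : EucN N → ℝ := fun x => radExp N k lam *
    (∑ i, x i * pderiv i F x / ‖x‖ ^ 2 + ((N : ℝ) - 2) * F x / ‖x‖ ^ 2)
  have hB3 : Integrable T (cornerMeasure N k) ∧ ∫ x, T x ∂(cornerMeasure N k) = 0 := by
    -- For λ = 0 the factor s is zero. Otherwise φ/|x| and ψ/|x| are in L², which yields the
    -- integrability needed for the radial field.
    by_cases h0 : lam = 0
    · simp [T, radExp_eq_zero hN h0]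
    · have hφL := hφ.memLp_div_norm h0
      have hψL := hψ.memLp_div_norm h0
      have hd : ∀ {χ : EucN N → ℝ}, IsTestFun N k lam χ → ∀ i, MemLp (pderiv i χ) 2 volume :=
        fun hχ i => (hχ.contDiff_one.continuous_pderiv i).memLp_of_hasCompactSupport
          (hχ.compact.pderiv i)
      have key := integral_radial_divergence hF1 hFc
        ((hφL.integrable_mul hψL).congr (Eventually.of_forall fun x => by
          simp only [hFdef, Pi.mul_apply]; field_simp))
        (fun i => (((hd hφ i).integrable_mul hψL).add (hφL.integrable_mul (hd hψ i))).congr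
          (Eventually.of_forall fun x => by
            simp only [hDF, Pi.mul_apply, Pi.add_apply]; field_simp))
      refine ⟨(key.1.const_mul _).restrict, ?_⟩
      rw [integral_corner_eq]
      · simp only [T]
        rw [integral_const_mul, key.2, mul_zero]
      · intro x hx
        by_contra hx'
        have hx1 : x ∉ tsupport F := fun h => hx' (hFs h)
        refine hx ?_
        simp [T, pderiv_eq_zero_of_notMem_tsupport _ hx1, image_eq_zero_of_notMem_tsupport hx1]
  -- Pointwise, ∇φ·∇ψ = Dφ·Dψ + div(Fg) - (div g + |g|²)F, and the Riccati identity evaluates the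
  -- last bracket.
  have hpt : ∀ᵐ x ∂(cornerMeasure N k),
      inner ℝ (gradient φ x) (gradient ψ x) - lam / ‖x‖ ^ 2 * (φ x * ψ x)
        + ‖x‖ ^ 2 / 16 * (φ x * ψ x) =
      (groundEnergy N k lam * F x +
        ∑ i, twistedGrad N k lam i φ x * twistedGrad N k lam i ψ x) +
      ((-(1 / 4) * ∑ i, pderiv i (fun x => x i * F x) x) + T x +
        ∑ i ∈ faceIdx N k, pderiv i (fun x => (x i)⁻¹ * F x) x) := by
    filter_upwards [ae_corner_mem N k] with x hx
    obtain ⟨hxc, hx0⟩ := hx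
    have hx0 : x ≠ 0 := hx0
    have hr : ‖x‖ ^ 2 ≠ 0 := by simpa using hx0
    have hFd : DifferentiableAt ℝ F x := hF1.differentiable one_ne_zero x
    have e1 : ∀ i, pderiv i (fun x => x i * F x) x = F x + x i * pderiv i F x := fun i => by
      rw [pderiv_mul i (hasFDerivAt_coord i x).differentiableAt hFd, pderiv_coord]; simp
    have e2 : ∀ i ∈ faceIdx N k, pderiv i (fun x => (x i)⁻¹ * F x) x =
        (x i)⁻¹ * pderiv i F x - (x i)⁻¹ ^ 2 * F x := fun i hi => by
      have hne := (pos_of_mem_faceIdx hi hxc).ne'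
      have hd : DifferentiableAt ℝ (fun y : EucN N => (y i)⁻¹) x :=
        (hasFDerivAt_coord i x).differentiableAt.fun_inv hne
      rw [pderiv_mul i hd hFd,
        pderiv_comp (f := fun y : EucN N => y i) (g := fun t => t⁻¹) i (hasDerivAt_inv hne)
          (hasFDerivAt_coord i x).differentiableAt, pderiv_coord]
      simp; ring
    have e3 : ∑ i, twistedGrad N k lam i φ x * twistedGrad N k lam i ψ x =
        ∑ i, pderiv i φ x * pderiv i ψ x - ∑ i, logGrad N k lam i x * pderiv i F x +
          (∑ i, logGrad N k lam i x ^ 2) * F x := by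
      rw [Finset.sum_mul, ← Finset.sum_sub_distrib, ← Finset.sum_add_distrib]
      refine Finset.sum_congr rfl fun i _ => ?_
      rw [hDF]
      simp only [twistedGrad, hFdef]
      ring
    have e4 : ∑ i, logGrad N k lam i x * pderiv i F x =
        -(1 / 4) * ∑ i, x i * pderiv i F x + radExp N k lam * ∑ i, x i * pderiv i F x / ‖x‖ ^ 2 +
          ∑ i ∈ faceIdx N k, (x i)⁻¹ * pderiv i F x := by
      have : ∑ i ∈ faceIdx N k, (x i)⁻¹ * pderiv i F x =
          ∑ i, if i ∈ faceIdx N k then (x i)⁻¹ * pderiv i F x else 0 := by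
        rw [Finset.sum_ite_mem, Finset.univ_inter]
      rw [this, Finset.mul_sum, Finset.mul_sum, ← Finset.sum_add_distrib,
        ← Finset.sum_add_distrib]
      refine Finset.sum_congr rfl fun i _ => ?_
      unfold logGrad
      split_ifs <;> ring
    rw [inner_gradient_eq_sum, e3, e4, Finset.sum_congr rfl e2]
    simp_rw [e1]
    rw [Finset.sum_add_distrib, Finset.sum_sub_distrib, ← Finset.sum_mul (faceIdx N k), Finset.sum_const,
      sum_logGrad_sq hk hxc hx0]
    simp only [T, Finset.card_univ, Fintype.card_fin, nsmul_eq_mul, groundEnergy]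
    have hm : mLam N k lam = radExp N k lam + ((N : ℝ) - 2) / 2 + k := by unfold radExp; ring
    have hl := radExp_mul hlam
    have hl' : lam / ‖x‖ ^ 2 = -(radExp N k lam ^ 2 / ‖x‖ ^ 2 +
        2 * radExp N k lam * k / ‖x‖ ^ 2 + radExp N k lam * (N - 2) / ‖x‖ ^ 2) := by
      rw [← add_div, ← add_div, hl]; ring
    rw [hm, hl']
    simp only [hFdef]
    ring
  rw [hardyForm, integral_congr_ae hpt, integral_add, integral_add, integral_const_mul,
    integral_finsetSum _ fun i _ => hA2 i, integral_add, integral_add, integral_const_mul,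
    integral_finsetSum _ fun i _ => (hB1 i).1, integral_finsetSum _ fun i hi => (hB2 i hi).1,
    hB3.2, Finset.sum_eq_zero fun i _ => (hB1 i).2, Finset.sum_eq_zero fun i hi => (hB2 i hi).2]
  · simp
  · exact (integrable_finsetSum _ fun i _ => (hB1 i).1).const_mul _
  · exact hB3.1
  · exact ((integrable_finsetSum _ fun i _ => (hB1 i).1).const_mul _).add hB3.1
  · exact integrable_finsetSum _ fun i hi => (hB2 i hi).1
  · exact hA1.const_mul _
  · exact integrable_finsetSum _ fun i _ => hA2 i
  · exact (hA1.const_mul _).add (integrable_finsetSum _ fun i _ => hA2 i)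
  · exact (((integrable_finsetSum _ fun i _ => (hB1 i).1).const_mul _).add hB3.1).add
      (integrable_finsetSum _ fun i hi => (hB2 i hi).1)

end IsTestFun

/-! ### Positivity, smoothness and logarithmic derivative of the ground state. -/

/-- The logarithm of the ground state. -/
def logAlpha (N k : ℕ) (lam : ℝ) (x : EucN N) : ℝ :=
  -(1 / 8) * ‖x‖ ^ 2 + radExp N k lam / 2 * Real.log (‖x‖ ^ 2) + ∑ i ∈ faceIdx N k, Real.log (x i)

section GroundState

variable {N k : ℕ} {lam : ℝ} {x : EucN N}

theorem alphaFun_eq_exp (hx : x ∈ cornerSpace N k \ {0}) :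
    alphaFun N k lam x = Real.exp (logAlpha N k lam x) := by
  have hr : 0 < ‖x‖ := norm_pos_iff.mpr hx.2
  have e1 : ∏ i ∈ faceIdx N k, x i = Real.exp (∑ i ∈ faceIdx N k, Real.log (x i)) := by
    rw [Real.exp_sum]
    exact Finset.prod_congr rfl fun i hi => (Real.exp_log (pos_of_mem_faceIdx hi hx.1)).symm
  have e2 : ‖x‖ ^ (mLam N k lam - ((N : ℝ) - 2) / 2) / ‖x‖ ^ k =
      Real.exp (radExp N k lam / 2 * Real.log (‖x‖ ^ 2)) := by
    rw [← Real.rpow_natCast, ← Real.rpow_sub hr, Real.rpow_def_of_pos hr, Real.log_pow]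
    congr 1
    unfold radExp
    push_cast
    ring
  unfold alphaFun logAlpha
  rw [← faceIdx, e1, Real.exp_add, Real.exp_add, ← e2]
  rw [show -‖x‖ ^ 2 / 8 = -(1 / 8) * ‖x‖ ^ 2 by ring]
  ring

theorem alphaFun_pos (hx : x ∈ cornerSpace N k \ {0}) : 0 < alphaFun N k lam x := by
  rw [alphaFun_eq_exp hx]; exact Real.exp_pos _

theorem isOpen_punctured (N k : ℕ) : IsOpen (cornerSpace N k \ {(0 : EucN N)}) :=
  (isOpen_cornerSpace N k).sdiff isClosed_singleton

theorem alphaFun_eventuallyEq (hx : x ∈ cornerSpace N k \ {0}) :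
    alphaFun N k lam =ᶠ[𝓝 x] fun y => Real.exp (logAlpha N k lam y) := by
  filter_upwards [(isOpen_punctured N k).mem_nhds hx] with y hy using alphaFun_eq_exp hy

theorem contDiffAt_logAlpha (hx : x ∈ cornerSpace N k \ {0}) :
    ContDiffAt ℝ ∞ (logAlpha N k lam) x := by
  have hr : ‖x‖ ^ 2 ≠ 0 := by simpa using hx.2
  refine ((contDiff_const.mul (contDiff_norm_sq ℝ)).contDiffAt.add
    (contDiffAt_const.mul ((contDiff_norm_sq ℝ).contDiffAt.log hr))).add ?_
  exact ContDiffAt.sum fun i hi =>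
    (contDiff_coord i).contDiffAt.log (pos_of_mem_faceIdx hi hx.1).ne'

theorem contDiffAt_alphaFun (hx : x ∈ cornerSpace N k \ {0}) :
    ContDiffAt ℝ ∞ (alphaFun N k lam) x :=
  (contDiffAt_logAlpha hx).exp.congr_of_eventuallyEq (alphaFun_eventuallyEq hx)

theorem pderiv_logAlpha (i : Fin N) (hx : x ∈ cornerSpace N k \ {0}) :
    pderiv i (logAlpha N k lam) x = logGrad N k lam i x := by
  have hr : ‖x‖ ^ 2 ≠ 0 := by simpa using hx.2
  have h1 : HasFDerivAt (fun y : EucN N => ‖y‖ ^ 2) (2 • innerSL ℝ x) x :=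
    (hasStrictFDerivAt_norm_sq x).hasFDerivAt
  have h2 := (((h1.const_mul (-(1 / 8))).add ((h1.log hr).const_mul (radExp N k lam / 2)))).add
    (HasFDerivAt.fun_sum fun i hi =>
      (hasFDerivAt_coord i x).log (pos_of_mem_faceIdx hi hx.1).ne')
  have h3 := h2.pderiv_eq i
  refine Eq.trans h3 ?_
  have e : ∀ j ∈ faceIdx N k, (x j)⁻¹ * (EuclideanSpace.single i (1 : ℝ) : EucN N) j =
      if i = j then (x j)⁻¹ else 0 := by
    intro j _
    by_cases h : i = j <;> simp [h, eq_comm]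
  simp only [_root_.add_apply, _root_.smul_apply,
    _root_.sum_apply, PiLp.proj_apply, smul_eq_mul, innerSL_apply_apply,
    EuclideanSpace.inner_single_right, Finset.sum_congr rfl e, Finset.sum_ite_eq]
  unfold logGrad
  simp only [nsmul_eq_mul, RCLike.conj_to_real]
  push_cast
  split_ifs <;> ring

theorem pderiv_alphaFun (i : Fin N) (hx : x ∈ cornerSpace N k \ {0}) :
    pderiv i (alphaFun N k lam) x = logGrad N k lam i x * alphaFun N k lam x := by
  rw [(alphaFun_eventuallyEq hx).pderiv_eq,
    pderiv_exp i ((contDiffAt_logAlpha hx).differentiableAt (by simp)), pderiv_logAlpha i hx,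
    alphaFun_eq_exp hx, mul_comm]

/-- If k = 0 this is the complement of a point in dimension at least 2. If k > 0 the origin is
already excluded and the corner space is convex. -/
theorem isPreconnected_punctured (hN : 2 ≤ N) :
    IsPreconnected (cornerSpace N k \ {(0 : EucN N)}) := by
  rcases Nat.eq_zero_or_pos k with rfl | hk
  · have : cornerSpace N 0 \ {(0 : EucN N)} = {(0 : EucN N)}ᶜ := by
      ext y
      simp only [cornerSpace, Set.mem_sdiff, Set.mem_ofPred_eq, Set.mem_compl_iff,
        and_iff_right_iff_imp]
      intro _ i hi
      have := i.2
      omega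
    rw [this]
    refine (isConnected_compl_singleton_of_one_lt_rank ?_ 0).isPreconnected
    rw [← Module.finrank_eq_rank]
    simp only [finrank_euclideanSpace, Fintype.card_fin]
    exact_mod_cast hN
  · have : cornerSpace N k \ {(0 : EucN N)} = cornerSpace N k := by
      ext y
      simp only [Set.mem_sdiff, Set.mem_singleton_iff, and_iff_left_iff_imp]
      rintro hy rfl
      have := hy ⟨N - 1, by omega⟩ (by simp; omega)
      simp at this
    rw [this]
    refine Convex.isPreconnected fun a ha b hb s t hs ht hst i hi => ?_
    have h1 := ha i hi
    have h2 := hb i hi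
    simp only [PiLp.add_apply, PiLp.smul_apply, smul_eq_mul]
    rcases hs.eq_or_lt with rfl | hs
    · have : t = 1 := by linarith
      simp [this, h2]
    · have := mul_pos hs h1
      have := mul_nonneg ht h2.le
      linarith

end GroundState

/-! ### The closed form in terms of twisted gradients. -/

section TwistedGradZero

variable {N k : ℕ} {lam : ℝ}

instance (N k : ℕ) : IsLocallyFiniteMeasure (cornerMeasure N k) := by
  unfold cornerMeasure; infer_instance

theorem inner_toLp_eq {f g : EucN N → ℝ} (hf : MemLp f 2 (cornerMeasure N k))
    (hg : MemLp g 2 (cornerMeasure N k)) :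
    inner ℝ (hf.toLp f) (hg.toLp g) = ∫ x, f x * g x ∂(cornerMeasure N k) := by
  rw [L2.inner_def]
  refine integral_congr_ae ?_
  filter_upwards [hf.coeFn_toLp, hg.coeFn_toLp] with x h1 h2
  simp [h1, h2, mul_comm]

theorem inner_toLp_right {f : EucN N → ℝ} (u : CornerL2 N k)
    (hf : MemLp f 2 (cornerMeasure N k)) :
    inner ℝ u (hf.toLp f) = ∫ x, u x * f x ∂(cornerMeasure N k) := by
  rw [L2.inner_def]
  refine integral_congr_ae ?_
  filter_upwards [hf.coeFn_toLp] with x h1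
  simp [h1, mul_comm]

theorem norm_toLp_sq {f : EucN N → ℝ} (hf : MemLp f 2 (cornerMeasure N k)) :
    ‖hf.toLp f‖ ^ 2 = ∫ x, f x ^ 2 ∂(cornerMeasure N k) := by
  rw [← real_inner_self_eq_norm_sq, inner_toLp_eq]
  simp_rw [sq]

/-- `u` annihilates the formal adjoint of the twisted gradient. -/
def TwistedGradZero (N k : ℕ) (lam : ℝ) (u : CornerL2 N k) : Prop :=
  ∀ (i : Fin N) (ψ : EucN N → ℝ), ContDiff ℝ ∞ ψ → HasCompactSupport ψ →
    tsupport ψ ⊆ cornerSpace N k \ {0} →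
    ∫ x, u x * (pderiv i ψ x + logGrad N k lam i x * ψ x) ∂(cornerMeasure N k) = 0

/-- The formal adjoint differs from D only in the sign of g: ∂ψ + gψ = 2∂ψ - Dψ. -/
theorem adjoint_memLp (hN : 2 ≤ N) {ψ : EucN N → ℝ} (h : IsTestFun N k lam ψ) (i : Fin N) :
    MemLp (fun x => pderiv i ψ x + logGrad N k lam i x * ψ x) 2 (cornerMeasure N k) := by
  refine (((h.pderiv_memLp i).const_mul 2).sub (h.twistedGrad_memLp hN i)).ae_eq
    (Eventually.of_forall fun x => ?_)
  simp only [Pi.sub_apply, twistedGrad]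
  ring

/-- The terms in g cancel, so the two integrands add up to ∂_i(φψ). -/
theorem integral_twistedGrad_mul {φ ψ : EucN N → ℝ} (hφ : ContDiff ℝ ∞ φ)
    (hψ : ContDiff ℝ ∞ ψ) (hc : HasCompactSupport ψ) (hs : tsupport ψ ⊆ cornerSpace N k)
    (i : Fin N)
    (h1 : Integrable (fun x => twistedGrad N k lam i φ x * ψ x) (cornerMeasure N k))
    (h2 : Integrable (fun x => φ x * (pderiv i ψ x + logGrad N k lam i x * ψ x))
      (cornerMeasure N k)) :
    ∫ x, twistedGrad N k lam i φ x * ψ x ∂(cornerMeasure N k) =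
      -∫ x, φ x * (pderiv i ψ x + logGrad N k lam i x * ψ x) ∂(cornerMeasure N k) := by
  rw [eq_neg_iff_add_eq_zero, ← integral_add h1 h2]
  refine Eq.trans ?_ (integral_corner_pderiv_eq_zero (k := k) i
    ((hφ.mul hψ).of_le (by simp)) hc.mul_left (tsupport_mul_subset_right.trans hs)).2
  refine integral_congr_ae (Eventually.of_forall fun x => ?_)
  simp only
  rw [pderiv_mul i (hφ.differentiable (by simp) x) (hψ.differentiable (by simp) x), twistedGrad]
  ring

theorem Lp_eq_zero_of_inner_testFun [Nonempty (Fin N)] {V : CornerL2 N k}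
    (h : ∀ ψ : EucN N → ℝ, ContDiff ℝ ∞ ψ → HasCompactSupport ψ →
      tsupport ψ ⊆ cornerSpace N k \ {0} → ∫ x, V x * ψ x ∂(cornerMeasure N k) = 0) : V = 0 := by
  have hloc : LocallyIntegrable (⇑V) (cornerMeasure N k) :=
    (Lp.memLp V).locallyIntegrable (by norm_num)
  have key := (isOpen_punctured N k).ae_eq_zero_of_integral_contDiff_smul_eq_zero
    (hloc.locallyIntegrableOn _) fun ψ h1 h2 h3 => by
      simpa [mul_comm] using h ψ h1 h2 h3
  apply Lp.ext
  filter_upwards [key, ae_corner_mem N k, Lp.coeFn_zero ℝ 2 (cornerMeasure N k)] with x hx hx1 hx3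
  rw [hx3]
  exact hx hx1

theorem tendsto_toLp_of_formApprox {u : CornerL2 N k} {φ : ℕ → EucN N → ℝ}
    (h : FormApprox N k lam u φ) :
    Tendsto (fun n => (h.test n).memLp.toLp (φ n)) atTop (𝓝 u) := by
  have h1 := (Lp.tendsto_Lp_iff_tendsto_eLpNorm'' φ (fun n => (h.test n).memLp) u
    (Lp.memLp u)).mpr h.tendsto
  rwa [Lp.toLp_coeFn] at h1

theorem hardyForm_eq_inner (hN : 2 ≤ N) (hk : k ≤ N) (hlam : lam ≤ hardyConst N k)
    {φ ψ : EucN N → ℝ} (hφ : IsTestFun N k lam φ) (hψ : IsTestFun N k lam ψ) :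
    hardyForm N k lam φ ψ =
      groundEnergy N k lam * inner ℝ (hφ.memLp.toLp φ) (hψ.memLp.toLp ψ) +
      ∑ i, inner ℝ ((hφ.twistedGrad_memLp hN i).toLp (twistedGrad N k lam i φ))
        ((hψ.twistedGrad_memLp hN i).toLp (twistedGrad N k lam i ψ)) := by
  rw [hφ.hardyForm_eq hN hk hlam hψ, inner_toLp_eq]
  congr 1
  exact Finset.sum_congr rfl fun i _ => (inner_toLp_eq _ _).symm

theorem twistedGrad_sub {φ ψ : EucN N → ℝ} (hφ : IsTestFun N k lam φ)
    (hψ : IsTestFun N k lam ψ) (i : Fin N) :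
    twistedGrad N k lam i (φ - ψ) = twistedGrad N k lam i φ - twistedGrad N k lam i ψ := by
  funext x
  simp only [twistedGrad, Pi.sub_apply]
  rw [show φ - ψ = fun y => φ y - ψ y from rfl,
    pderiv_sub i (hφ.differentiableAt x) (hψ.differentiableAt x)]
  ring

/-- Together with E > 0, this makes being Cauchy in the form norm the same as being Cauchy in L² for
the functions and each twisted gradient. -/
theorem hardyForm_sub_self (hN : 2 ≤ N) (hk : k ≤ N) (hlam : lam ≤ hardyConst N k)
    {φ ψ : EucN N → ℝ} (hφ : IsTestFun N k lam φ) (hψ : IsTestFun N k lam ψ) :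
    hardyForm N k lam (φ - ψ) (φ - ψ) =
      groundEnergy N k lam * ‖hφ.memLp.toLp φ - hψ.memLp.toLp ψ‖ ^ 2 +
      ∑ i, ‖(hφ.twistedGrad_memLp hN i).toLp (twistedGrad N k lam i φ) -
        (hψ.twistedGrad_memLp hN i).toLp (twistedGrad N k lam i ψ)‖ ^ 2 := by
  rw [hardyForm_eq_inner hN hk hlam (hφ.sub hψ) (hφ.sub hψ), real_inner_self_eq_norm_sq,
    MemLp.toLp_sub hφ.memLp hψ.memLp]
  congr 1
  refine Finset.sum_congr rfl fun i _ => ?_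
  rw [real_inner_self_eq_norm_sq, ← MemLp.toLp_sub]
  congr 3
  exact twistedGrad_sub hφ hψ i

/-- Convergence of the functions and of their twisted gradients in `L²` is convergence in the
form sense. -/
theorem formApprox_of_tendsto (hN : 2 ≤ N) (hk : k ≤ N) (hlam : lam ≤ hardyConst N k)
    {φ : ℕ → EucN N → ℝ} (ht : ∀ n, IsTestFun N k lam (φ n)) {u : CornerL2 N k}
    (hu : Tendsto (fun n => (ht n).memLp.toLp (φ n)) atTop (𝓝 u)) {V : Fin N → CornerL2 N k}
    (hV : ∀ i, Tendsto (fun n => ((ht n).twistedGrad_memLp hN i).toLp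
      (twistedGrad N k lam i (φ n))) atTop (𝓝 (V i))) :
    FormApprox N k lam u φ := by
  refine ⟨ht, fun ε hε => ?_, ?_⟩
  · have h1 : ∀ {f : ℕ → CornerL2 N k} {w : CornerL2 N k}, Tendsto f atTop (𝓝 w) →
        Tendsto (fun p : ℕ × ℕ => ‖f p.1 - f p.2‖ ^ 2) (atTop ×ˢ atTop) (𝓝 0) := by
      intro f w hf
      have := (((hf.comp tendsto_fst).sub (hf.comp tendsto_snd)).norm.pow 2 :
        Tendsto (fun p : ℕ × ℕ => ‖f p.1 - f p.2‖ ^ 2) (atTop ×ˢ atTop) _)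
      simpa using this
    have h2 : Tendsto (fun p : ℕ × ℕ => hardyNorm N k lam (φ p.1 - φ p.2))
        (atTop ×ˢ atTop) (𝓝 0) := by
      have h3 := (((h1 hu).const_mul (groundEnergy N k lam)).add
        (tendsto_finsetSum Finset.univ fun i _ => h1 (hV i))).sqrt
      simp only [mul_zero, Finset.sum_const_zero, add_zero, Real.sqrt_zero] at h3
      refine h3.congr fun p => ?_
      rw [hardyNorm, hardyForm_sub_self hN hk hlam (ht p.1) (ht p.2)]
    have h4 := h2.eventually (gt_mem_nhds hε)
    rw [prod_atTop_atTop_eq, eventually_atTop_prod_self] at h4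
    exact h4
  · have h1 := (Lp.tendsto_Lp_iff_tendsto_eLpNorm'' φ (fun n => (ht n).memLp) u
      (Lp.memLp u)).mp (by rwa [Lp.toLp_coeFn])
    exact h1

/-- Along an approximating sequence the twisted gradients converge in `L²`. -/
theorem FormApprox.exists_tendsto_twistedGrad (hN : 2 ≤ N) (hk : k ≤ N)
    (hlam : lam ≤ hardyConst N k) {u : CornerL2 N k} {φ : ℕ → EucN N → ℝ}
    (h : FormApprox N k lam u φ) : ∃ V : Fin N → CornerL2 N k,
      ∀ i, Tendsto (fun n => ((h.test n).twistedGrad_memLp hN i).toLp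
        (twistedGrad N k lam i (φ n))) atTop (𝓝 (V i)) := by
  suffices hs : ∀ i, ∃ V, Tendsto (fun n => ((h.test n).twistedGrad_memLp hN i).toLp
      (twistedGrad N k lam i (φ n))) atTop (𝓝 V) by
    choose V hV using hs
    exact ⟨V, hV⟩
  intro i
  refine cauchySeq_tendsto_of_complete (Metric.cauchySeq_iff.mpr fun ε hε => ?_)
  obtain ⟨n₀, hn₀⟩ := h.cauchy ε hε
  refine ⟨n₀, fun m hm n hn => ?_⟩
  have h1 := (Real.sqrt_lt' hε).mp (hn₀ m n hm hn)
  rw [hardyForm_sub_self hN hk hlam (h.test m) (h.test n)] at h1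
  rw [dist_eq_norm]
  refine lt_of_pow_lt_pow_left₀ 2 hε.le (lt_of_le_of_lt ?_ h1)
  -- One twisted gradient is controlled by the whole form: the other summands and the E-term are
  -- nonnegative.
  have h2 := Finset.single_le_sum (f := fun i =>
    ‖((h.test m).twistedGrad_memLp hN i).toLp (twistedGrad N k lam i (φ m)) -
      ((h.test n).twistedGrad_memLp hN i).toLp (twistedGrad N k lam i (φ n))‖ ^ 2)
    (fun j _ => sq_nonneg _) (Finset.mem_univ i)
  have h3 := mul_nonneg (groundEnergy_pos (N := N) (k := k) (lam := lam)).le (sq_nonneg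
    ‖(h.test m).memLp.toLp (φ m) - (h.test n).memLp.toLp (φ n)‖)
  linarith

theorem tendsto_hardyForm (hN : 2 ≤ N) (hk : k ≤ N) (hlam : lam ≤ hardyConst N k)
    {u v : CornerL2 N k} {φ ψ : ℕ → EucN N → ℝ} (hφ : FormApprox N k lam u φ)
    (hψ : FormApprox N k lam v ψ) {V W : Fin N → CornerL2 N k}
    (hV : ∀ i, Tendsto (fun n => ((hφ.test n).twistedGrad_memLp hN i).toLp
      (twistedGrad N k lam i (φ n))) atTop (𝓝 (V i)))
    (hW : ∀ i, Tendsto (fun n => ((hψ.test n).twistedGrad_memLp hN i).toLp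
      (twistedGrad N k lam i (ψ n))) atTop (𝓝 (W i))) :
    Tendsto (fun n => hardyForm N k lam (φ n) (ψ n)) atTop
      (𝓝 (groundEnergy N k lam * inner ℝ u v + ∑ i, inner ℝ (V i) (W i))) := by
  have h1 := ((tendsto_toLp_of_formApprox hφ).inner (𝕜 := ℝ)
    (tendsto_toLp_of_formApprox hψ)).const_mul (groundEnergy N k lam)
  refine (h1.add (tendsto_finsetSum Finset.univ fun i _ => (hV i).inner (𝕜 := ℝ) (hW i))).congr
    fun n => ?_
  rw [hardyForm_eq_inner hN hk hlam (hφ.test n) (hψ.test n)]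

/-- The limit of the twisted gradients is the weak twisted gradient of the limit. -/
theorem FormApprox.integral_limit_mul (hN : 2 ≤ N) {u : CornerL2 N k} {φ : ℕ → EucN N → ℝ}
    (h : FormApprox N k lam u φ) {V : CornerL2 N k} {i : Fin N}
    (hV : Tendsto (fun n => ((h.test n).twistedGrad_memLp hN i).toLp
      (twistedGrad N k lam i (φ n))) atTop (𝓝 V))
    {ψ : EucN N → ℝ} (hψ : ContDiff ℝ ∞ ψ) (hc : HasCompactSupport ψ)
    (hs : tsupport ψ ⊆ cornerSpace N k \ {0}) :
    ∫ x, V x * ψ x ∂(cornerMeasure N k) =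
      -∫ x, u x * (pderiv i ψ x + logGrad N k lam i x * ψ x) ∂(cornerMeasure N k) := by
  have ht := isTestFun_of_supp N k lam ψ hψ hc hs
  have hadj := adjoint_memLp hN ht i
  have h1 := hV.inner (𝕜 := ℝ) (tendsto_const_nhds (x := ht.memLp.toLp ψ))
  have h2 := ((tendsto_toLp_of_formApprox h).inner (𝕜 := ℝ)
    (tendsto_const_nhds (x := hadj.toLp _))).neg
  rw [inner_toLp_right] at h1 h2
  refine tendsto_nhds_unique h1 (h2.congr fun n => ?_)
  rw [inner_toLp_eq, inner_toLp_eq, integral_twistedGrad_mul (h.test n).smooth hψ hc ht.supp i]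
  · exact ((h.test n).twistedGrad_memLp hN i).integrable_mul ht.memLp
  · exact (h.test n).memLp.integrable_mul hadj

/-- The limit V is determined weakly by u alone, whichever approximating sequence is used. -/
theorem TwistedGradZero.limit_eq_zero (hN : 2 ≤ N) {u : CornerL2 N k} {φ : ℕ → EucN N → ℝ}
    (hu : TwistedGradZero N k lam u) (h : FormApprox N k lam u φ) {V : CornerL2 N k} {i : Fin N}
    (hV : Tendsto (fun n => ((h.test n).twistedGrad_memLp hN i).toLp
      (twistedGrad N k lam i (φ n))) atTop (𝓝 V)) : V = 0 := by
  have : Nonempty (Fin N) := ⟨⟨0, by omega⟩⟩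
  refine Lp_eq_zero_of_inner_testFun fun ψ h1 h2 h3 => ?_
  rw [h.integral_limit_mul hN hV h1 h2 h3, hu i ψ h1 h2 h3, neg_zero]

/-- Every approximating sequence of u has twisted gradients tending to 0, so only the term E(u,v)
survives in the limit of the form. -/
theorem TwistedGradZero.isRepresentedBy (hN : 2 ≤ N) (hk : k ≤ N) (hlam : lam ≤ hardyConst N k)
    {u : CornerL2 N k} (hu : TwistedGradZero N k lam u) (hd : u ∈ formDomain N k lam) :
    IsRepresentedBy N k lam u (groundEnergy N k lam • u) := by
  refine ⟨hd, fun v hv => ⟨hd, hv, fun φ ψ hφ hψ => ?_⟩⟩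
  obtain ⟨V, hV⟩ := hφ.exists_tendsto_twistedGrad hN hk hlam
  obtain ⟨W, hW⟩ := hψ.exists_tendsto_twistedGrad hN hk hlam
  have h1 := tendsto_hardyForm hN hk hlam hφ hψ hV hW
  have h2 : ∀ i, V i = 0 := fun i => hu.limit_eq_zero hN hφ (hV i)
  simpa [h2, inner_smul_left] using h1

/-- Testing the equation with u gives c‖u‖² = E‖u‖² + Σ‖V_i‖². Both the lower bound on eigenvalues
and the case of equality follow from it. -/
theorem IsRepresentedBy.sum_norm_sq (hN : 2 ≤ N) (hk : k ≤ N) (hlam : lam ≤ hardyConst N k)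
    {u : CornerL2 N k} {c : ℝ} (hu : IsRepresentedBy N k lam u (c • u)) {φ : ℕ → EucN N → ℝ}
    (hφ : FormApprox N k lam u φ) {V : Fin N → CornerL2 N k}
    (hV : ∀ i, Tendsto (fun n => ((hφ.test n).twistedGrad_memLp hN i).toLp
      (twistedGrad N k lam i (φ n))) atTop (𝓝 (V i))) :
    ∑ i, ‖V i‖ ^ 2 = (c - groundEnergy N k lam) * ‖u‖ ^ 2 := by
  have h1 := tendsto_hardyForm hN hk hlam hφ hφ hV hV
  have h2 := tendsto_nhds_unique h1 ((hu.2 u hu.1).2.2 φ φ hφ hφ)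
  simp only [real_inner_self_eq_norm_sq, inner_smul_left, RCLike.conj_to_real] at h2
  linarith

theorem IsRepresentedBy.groundEnergy_le (hN : 2 ≤ N) (hk : k ≤ N) (hlam : lam ≤ hardyConst N k)
    {u : CornerL2 N k} {c : ℝ} (hu : IsRepresentedBy N k lam u (c • u)) (h0 : u ≠ 0) :
    groundEnergy N k lam ≤ c := by
  obtain ⟨φ, hφ⟩ := hu.1
  obtain ⟨V, hV⟩ := hφ.exists_tendsto_twistedGrad hN hk hlam
  have h1 := hu.sum_norm_sq hN hk hlam hφ hV
  have h2 : 0 ≤ ∑ i, ‖V i‖ ^ 2 := Finset.sum_nonneg fun i _ => sq_nonneg _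
  have h3 : 0 < ‖u‖ ^ 2 := by positivity
  rw [h1] at h2
  linarith [nonneg_of_mul_nonneg_left h2 h3]

theorem IsRepresentedBy.twistedGradZero (hN : 2 ≤ N) (hk : k ≤ N) (hlam : lam ≤ hardyConst N k)
    {u : CornerL2 N k} (hu : IsRepresentedBy N k lam u (groundEnergy N k lam • u)) :
    TwistedGradZero N k lam u := by
  obtain ⟨φ, hφ⟩ := hu.1
  obtain ⟨V, hV⟩ := hφ.exists_tendsto_twistedGrad hN hk hlam
  have h1 := hu.sum_norm_sq hN hk hlam hφ hV
  rw [sub_self, zero_mul, Finset.sum_eq_zero_iff_of_nonneg fun i _ => sq_nonneg _] at h1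
  intro i ψ h2 h3 h4
  have h5 := hφ.integral_limit_mul hN (hV i) h2 h3 h4
  have h6 : V i = 0 := by simpa using h1 i (Finset.mem_univ i)
  rw [← neg_eq_zero, ← h5]
  refine integral_eq_zero_of_ae ?_
  filter_upwards [Lp.coeFn_zero ℝ 2 (cornerMeasure N k)] with x hx
  rw [h6, hx]
  simp

theorem mem_eigenspaceL_iff (hN : 2 ≤ N) {u : CornerL2 N k} {c : ℝ} :
    u ∈ eigenspaceL N k lam c ↔ IsRepresentedBy N k lam u (c • u) :=
  ⟨fun ⟨h, e⟩ => (hardyOp_eq_iff N k (by omega) lam ⟨u, h⟩ _).mp e,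
    fun h => ⟨⟨_, h⟩, (hardyOp_eq_iff N k (by omega) lam ⟨u, _, h⟩ _).mpr h⟩⟩

end TwistedGradZero

/-! ### Weak solutions of Du = 0 are the multiples of α. -/

section Uniqueness

variable {N k : ℕ} {lam : ℝ}

theorem contDiff_mul_of_tsupport {f ψ : EucN N → ℝ} {U : Set (EucN N)}
    (hf : ∀ x ∈ U, ContDiffAt ℝ ∞ f x) (hψ : ContDiff ℝ ∞ ψ) (hs : tsupport ψ ⊆ U) :
    ContDiff ℝ ∞ fun x => f x * ψ x :=
  contDiff_of_contDiffAt_tsupport fun x hx =>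
    (hf x (hs (tsupport_mul_subset_right hx))).mul hψ.contDiffAt

/-- Because ∂_i α = g_i α, the integrand is c ∂_i(αψ), and αψ is smooth with compact support. -/
theorem twistedGradZero_smul_alpha (hN : 2 ≤ N)
    (hα : MemLp (alphaFun N k lam) 2 (cornerMeasure N k)) (c : ℝ) :
    TwistedGradZero N k lam (c • hα.toLp (alphaFun N k lam)) := by
  have : Nonempty (Fin N) := ⟨⟨0, by omega⟩⟩
  intro i ψ h1 h2 h3
  have hsm := contDiff_mul_of_tsupport (fun x hx => contDiffAt_alphaFun (lam := lam) hx) h1 h3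
  have key := (integral_corner_pderiv_eq_zero (k := k) i (hsm.of_le (by simp)) h2.mul_left
    (tsupport_mul_subset_right.trans (h3.trans Set.sdiff_subset))).2
  rw [← mul_zero c, ← key, ← integral_const_mul]
  refine integral_congr_ae ?_
  filter_upwards [Lp.coeFn_smul c (hα.toLp (alphaFun N k lam)), hα.coeFn_toLp,
    ae_corner_mem N k] with x e1 e2 hx
  rw [e1, Pi.smul_apply, e2, pderiv_mul i ((contDiffAt_alphaFun hx).differentiableAt (by simp))
    (h1.differentiable (by simp) x), pderiv_alphaFun i hx, smul_eq_mul]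
  ring

theorem locallyIntegrableOn_div_alpha (u : CornerL2 N k) :
    LocallyIntegrableOn (fun x => u x * (alphaFun N k lam x)⁻¹) (cornerSpace N k \ {0}) := by
  rw [locallyIntegrableOn_iff (isOpen_punctured N k).isLocallyClosed]
  intro K hKU hK
  refine IntegrableOn.mul_continuousOn ?_ ?_ hK
  · have h1 : LocallyIntegrable (⇑u) (cornerMeasure N k) :=
      (Lp.memLp u).locallyIntegrable (by norm_num)
    have h2 := h1.integrableOn_isCompact hK
    have h3 : (cornerMeasure N k).restrict K = volume.restrict K := by
      unfold cornerMeasure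
      rw [Measure.restrict_restrict hK.measurableSet,
        Set.inter_eq_left.mpr (hKU.trans Set.sdiff_subset)]
    rwa [IntegrableOn, h3] at h2
  · exact fun x hx => ((contDiffAt_alphaFun (hKU hx)).continuousAt.inv₀
      (alphaFun_pos (hKU hx)).ne').continuousWithinAt

theorem TwistedGradZero.eq_smul_alpha (hN : 2 ≤ N)
    (hα : MemLp (alphaFun N k lam) 2 (cornerMeasure N k)) {u : CornerL2 N k}
    (hu : TwistedGradZero N k lam u) : ∃ c : ℝ, u = c • hα.toLp (alphaFun N k lam) := by
  have : Nonempty (Fin N) := ⟨⟨0, by omega⟩⟩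
  obtain ⟨c, hc⟩ := exists_ae_const_of_weak_gradient_zero (isOpen_punctured N k)
    (isPreconnected_punctured hN) (locallyIntegrableOn_div_alpha (lam := lam) u) (by
      intro ψ h1 h2 h3 i
      have hinv : ∀ x ∈ cornerSpace N k \ {0},
          ContDiffAt ℝ ∞ (fun x => (alphaFun N k lam x)⁻¹) x := fun x hx =>
        (contDiffAt_alphaFun hx).inv (alphaFun_pos hx).ne'
      have hsm := contDiff_mul_of_tsupport hinv h1 h3
      -- Testing with ψ/α works because ∂_i(ψ/α) + g_i ψ/α = ∂_i ψ/α, so the weak gradient of u/α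
      -- vanishes.
      have key := hu i _ hsm h2.mul_left (tsupport_mul_subset_right.trans h3)
      rw [← key, ← integral_corner_eq (k := k)]
      · refine integral_congr_ae ?_
        filter_upwards [ae_corner_mem N k] with x hx
        have hne := (alphaFun_pos (lam := lam) hx).ne'
        have hd := (contDiffAt_alphaFun (lam := lam) hx).differentiableAt (by simp)
        rw [pderiv_mul i ((hinv x hx).differentiableAt (by simp))
          (h1.differentiable (by simp) x), pderiv_comp (f := alphaFun N k lam)
          (g := fun t => t⁻¹) i (hasDerivAt_inv hne) hd, pderiv_alphaFun i hx]
        field_simp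
        ring
      · intro x hx
        by_contra hx'
        exact hx (by
          simp [pderiv_eq_zero_of_notMem_tsupport i fun h => hx' (h3 h).1]))
  refine ⟨c, Lp.ext ?_⟩
  have hc' : ∀ᵐ x ∂(cornerMeasure N k), x ∈ cornerSpace N k \ {0} →
      u x * (alphaFun N k lam x)⁻¹ = c := ae_restrict_of_ae hc
  filter_upwards [hc', ae_corner_mem N k, hα.coeFn_toLp,
    Lp.coeFn_smul c (hα.toLp (alphaFun N k lam))] with x h1 h2 h3 h4
  rw [h4, Pi.smul_apply, h3, smul_eq_mul, ← h1 h2,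
    inv_mul_cancel_right₀ (alphaFun_pos h2).ne']

end Uniqueness

/-! ### Cutoffs near the origin, infinity and the faces. -/

/-- A smooth function on the line, equal to `1` on `[-1, 1]` and supported in `[-2, 2]`. -/
def lineBump : ContDiffBump (0 : ℝ) := ⟨1, 2, one_pos, one_lt_two⟩

theorem lineBump_eq_zero {y : ℝ} (h : 2 ≤ |y|) : lineBump y = 0 :=
  lineBump.zero_of_le_dist (by simpa [lineBump] using h)

theorem lineBump_eq_one {y : ℝ} (h : |y| ≤ 1) : lineBump y = 1 :=
  lineBump.one_of_mem_closedBall (by simpa [lineBump] using h)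

theorem deriv_lineBump_eq_zero {y : ℝ} (h : 2 < |y|) : deriv lineBump y = 0 := by
  have : (lineBump : ℝ → ℝ) =ᶠ[𝓝 y] fun _ => 0 := by
    filter_upwards [(isOpen_lt continuous_const continuous_abs).mem_nhds h] with z hz
    exact lineBump_eq_zero (le_of_lt hz)
  rw [this.deriv_eq, deriv_const]

theorem contDiff_lineBump {n : ℕ∞} : ContDiff ℝ n lineBump := lineBump.contDiff

theorem exists_deriv_lineBump_bound : ∃ C > 0, ∀ y, |deriv lineBump y| ≤ C := by
  obtain ⟨C, hC⟩ := lineBump.hasCompactSupport.deriv.exists_bound_of_continuous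
    ((contDiff_lineBump (n := 1)).continuous_deriv le_rfl)
  exact ⟨max C 1, by positivity, fun y => (hC y).trans (le_max_left _ _)⟩

/-- A logarithmic cutoff in the radial variable. -/
def radCut {N : ℕ} (n : ℕ) (x : EucN N) : ℝ := lineBump (Real.log (‖x‖ ^ 2) / (n + 1))

/-- A cutoff near the faces of the corner space. -/
def faceCut (N k j : ℕ) (x : EucN N) : ℝ := ∏ l ∈ faceIdx N k, (1 - lineBump ((j + 1) * x l))

/-- A cutoff near the boundary of the corner space, the origin and infinity. -/
def cutoff (N k n j : ℕ) : EucN N → ℝ :=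
  (cornerSpace N k \ {0}).indicator fun x => radCut n x * faceCut N k j x

section Cutoff

variable {N k : ℕ} {lam : ℝ} {x : EucN N}

theorem radCut_mem (n : ℕ) (x : EucN N) : 0 ≤ radCut n x ∧ radCut n x ≤ 1 :=
  ⟨lineBump.nonneg, lineBump.le_one⟩

theorem faceFactor_mem (t : ℝ) : 0 ≤ 1 - lineBump t ∧ 1 - lineBump t ≤ 1 :=
  ⟨sub_nonneg.mpr lineBump.le_one, sub_le_self _ lineBump.nonneg⟩

theorem prod_faceFactor_mem (S : Finset (Fin N)) (j : ℕ) (x : EucN N) :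
    0 ≤ ∏ l ∈ S, (1 - lineBump ((j + 1) * x l)) ∧ ∏ l ∈ S, (1 - lineBump ((j + 1) * x l)) ≤ 1 :=
  ⟨Finset.prod_nonneg fun _ _ => (faceFactor_mem _).1,
    Finset.prod_le_one (fun _ _ => (faceFactor_mem _).1) fun _ _ => (faceFactor_mem _).2⟩

theorem faceCut_mem (j : ℕ) (x : EucN N) : 0 ≤ faceCut N k j x ∧ faceCut N k j x ≤ 1 :=
  prod_faceFactor_mem _ j x

theorem contDiffAt_radCut (n : ℕ) (hx : x ≠ 0) : ContDiffAt ℝ ∞ (radCut n) x := by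
  have hr : ‖x‖ ^ 2 ≠ 0 := by simpa using hx
  exact contDiff_lineBump.contDiffAt.comp x
    (((contDiff_norm_sq ℝ).contDiffAt.log hr).div_const _)

theorem contDiff_faceFactor (j : ℕ) (l : Fin N) :
    ContDiff ℝ ∞ fun x : EucN N => 1 - lineBump ((j + 1) * x l) :=
  contDiff_const.sub (contDiff_lineBump.comp (contDiff_const.mul (contDiff_coord l)))

theorem contDiff_faceCut (j : ℕ) : ContDiff ℝ ∞ (faceCut N k j) :=
  contDiff_prod fun l _ => contDiff_faceFactor j l

theorem pderiv_radCut (n : ℕ) (i : Fin N) (hx : x ≠ 0) :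
    pderiv i (radCut n) x =
      deriv lineBump (Real.log (‖x‖ ^ 2) / (n + 1)) * (2 * x i / ‖x‖ ^ 2 / (n + 1)) := by
  have hr : ‖x‖ ^ 2 ≠ 0 := by simpa using hx
  have hd : DifferentiableAt ℝ (fun y : EucN N => ‖y‖ ^ 2) x :=
    (hasStrictFDerivAt_norm_sq x).differentiableAt
  have h1 : HasDerivAt (fun t => Real.log t / ((n : ℝ) + 1)) ((‖x‖ ^ 2)⁻¹ / (n + 1)) (‖x‖ ^ 2) :=
    (Real.hasDerivAt_log hr).div_const _
  have h2 : HasDerivAt (fun t => lineBump (Real.log t / ((n : ℝ) + 1)))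
      (deriv lineBump (Real.log (‖x‖ ^ 2) / (n + 1)) * ((‖x‖ ^ 2)⁻¹ / (n + 1))) (‖x‖ ^ 2) :=
    (((contDiff_lineBump (n := 1)).differentiable one_ne_zero _).hasDerivAt).comp _ h1
  have h3 := pderiv_comp (f := fun y : EucN N => ‖y‖ ^ 2) i h2 hd
  rw [pderiv_norm_sq] at h3
  refine h3.trans ?_
  ring

theorem pderiv_prod_faceFactor_eq_zero (j : ℕ) {i : Fin N} {S : Finset (Fin N)} (hi : i ∉ S)
    (x : EucN N) : pderiv i (fun y => ∏ l ∈ S, (1 - lineBump ((j + 1) * y l))) x = 0 := by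
  induction S using Finset.induction_on with
  | empty => simp [pderiv]
  | insert a S ha ih =>
    simp only [Finset.mem_insert, not_or] at hi
    simp_rw [Finset.prod_insert ha]
    rw [pderiv_mul i ((contDiff_faceFactor j a).differentiable (by simp) x)
      ((contDiff_prod fun l _ => contDiff_faceFactor j l).differentiable (n := ∞) (by simp) x),
      ih hi.2]
    have h1 : HasDerivAt (fun t => 1 - lineBump (((j : ℝ) + 1) * t))
        (deriv (fun t => 1 - lineBump (((j : ℝ) + 1) * t)) (x a)) (x a) := by
      refine DifferentiableAt.hasDerivAt ?_
      exact ((contDiff_const.sub (contDiff_lineBump.comp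
        (contDiff_const.mul contDiff_id))).differentiable (n := 1) one_ne_zero _)
    rw [pderiv_comp (f := fun y : EucN N => y a) i h1 (hasFDerivAt_coord a x).differentiableAt,
      pderiv_coord, if_neg hi.1]
    simp

theorem pderiv_faceCut (j : ℕ) (i : Fin N) (x : EucN N) :
    pderiv i (faceCut N k j) x = if i ∈ faceIdx N k then
      -(deriv lineBump ((j + 1) * x i) * (j + 1)) *
        ∏ l ∈ (faceIdx N k).erase i, (1 - lineBump ((j + 1) * x l)) else 0 := by
  split_ifs with hi
  · have e : faceCut N k j = fun y => (1 - lineBump ((j + 1) * y i)) *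
        ∏ l ∈ (faceIdx N k).erase i, (1 - lineBump ((j + 1) * y l)) := by
      funext y
      exact (Finset.mul_prod_erase _ _ hi).symm
    rw [e, pderiv_mul i ((contDiff_faceFactor j i).differentiable (by simp) x)
      ((contDiff_prod fun l _ => contDiff_faceFactor j l).differentiable (n := ∞) (by simp) x),
      pderiv_prod_faceFactor_eq_zero j (Finset.notMem_erase i _)]
    have h1 : HasDerivAt (fun t => 1 - lineBump (((j : ℝ) + 1) * t))
        (-(deriv lineBump ((j + 1) * x i) * (j + 1))) (x i) := by
      have h2 : HasDerivAt (fun t => ((j : ℝ) + 1) * t) ((j : ℝ) + 1) (x i) := by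
        simpa using (hasDerivAt_id (x i)).const_mul ((j : ℝ) + 1)
      have h3 := (((contDiff_lineBump (n := 1)).differentiable one_ne_zero
        (((j : ℝ) + 1) * x i)).hasDerivAt).comp _ h2
      exact h3.const_sub 1
    rw [pderiv_comp (f := fun y : EucN N => y i) i h1 (hasFDerivAt_coord i x).differentiableAt,
      pderiv_coord, if_pos rfl]
    simp
  · exact pderiv_prod_faceFactor_eq_zero j hi x

/-- The strict inequality places (j+1)x_l in an open set where the bump vanishes, so that its
derivative vanishes there as well. -/
theorem eventually_large (hx : x ∈ cornerSpace N k) :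
    ∀ᶠ j : ℕ in atTop, ∀ l ∈ faceIdx N k, 2 < |((j : ℝ) + 1) * x l| := by
  rw [Filter.eventually_all_finset]
  intro l hl
  have hp := pos_of_mem_faceIdx hl hx
  have h1 : Tendsto (fun j : ℕ => ((j : ℝ) + 1) * x l) atTop atTop :=
    (tendsto_atTop_add_const_right _ 1 tendsto_natCast_atTop_atTop).atTop_mul_const hp
  filter_upwards [h1.eventually_gt_atTop 2] with j hj using hj.trans_le (le_abs_self _)

theorem eventually_faceCut (hx : x ∈ cornerSpace N k) :
    ∀ᶠ j : ℕ in atTop, faceCut N k j x = 1 ∧ ∀ i, pderiv i (faceCut N k j) x = 0 := by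
  filter_upwards [eventually_large hx] with j hj
  refine ⟨Finset.prod_eq_one fun l hl => ?_, fun i => ?_⟩
  · rw [lineBump_eq_zero (hj l hl).le, sub_zero]
  · rw [pderiv_faceCut]
    split_ifs with hi
    · rw [deriv_lineBump_eq_zero (hj i hi)]; simp
    · rfl

/-- This includes x = 0, because `Real.log 0 = 0` gives the value `lineBump 0 = 1`. The formula
alone therefore does not cut off the origin exactly, and `cutoff` carries an indicator. -/
theorem eventually_radCut (x : EucN N) : ∀ᶠ n : ℕ in atTop, radCut n x = 1 := by
  filter_upwards [(tendsto_natCast_atTop_atTop (R := ℝ)).eventually_ge_atTop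
    |Real.log (‖x‖ ^ 2)|] with n hn
  refine lineBump_eq_one ?_
  rw [abs_div, abs_of_pos (by positivity : (0 : ℝ) < n + 1)]
  exact div_le_one_of_le₀ (by linarith) (by positivity)

theorem abs_pderiv_radCut_le {C : ℝ} (hC : ∀ y, |deriv lineBump y| ≤ C) (n : ℕ) (i : Fin N)
    (hx : x ≠ 0) : |pderiv i (radCut n) x| ≤ 2 * C / (n + 1) * ‖x‖⁻¹ := by
  have hr : 0 < ‖x‖ := norm_pos_iff.mpr hx
  have hn : (0 : ℝ) < n + 1 := by positivity
  rw [pderiv_radCut n i hx, abs_mul]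
  have h1 : |2 * x i / ‖x‖ ^ 2 / ((n : ℝ) + 1)| ≤ 2 / (n + 1) * ‖x‖⁻¹ := by
    rw [abs_div, abs_div, abs_mul, abs_of_pos hn, abs_of_pos (pow_pos hr 2), abs_two]
    calc 2 * |x i| / ‖x‖ ^ 2 / ((n : ℝ) + 1) ≤ 2 * ‖x‖ / ‖x‖ ^ 2 / ((n : ℝ) + 1) := by
          gcongr; exact abs_coord_le_norm x i
      _ = _ := by field_simp
  calc _ ≤ C * (2 / (n + 1) * ‖x‖⁻¹) :=
        mul_le_mul (hC _) h1 (abs_nonneg _) ((abs_nonneg _).trans (hC 0))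
    _ = _ := by ring

theorem exp_le_norm_of_radCut {n : ℕ} (hx : x ≠ 0)
    (h : |Real.log (‖x‖ ^ 2) / (n + 1)| ≤ 2) :
    Real.exp (-(n + 1)) ≤ ‖x‖ ∧ ‖x‖ ≤ Real.exp (n + 1) := by
  have hr : 0 < ‖x‖ := norm_pos_iff.mpr hx
  have hn : (0 : ℝ) < n + 1 := by positivity
  rw [abs_div, abs_of_pos hn, div_le_iff₀ hn, Real.log_pow, abs_le] at h
  push_cast at h
  rw [← Real.exp_log hr, Real.exp_le_exp, Real.exp_le_exp]
  constructor <;> linarith [h.1, h.2]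

/-- The derivative is nonzero only where (j+1)x_i ≤ 2, so the factor j+1 is at most 2/x_i. The bound
is uniform in j, as dominated convergence requires. -/
theorem abs_pderiv_faceCut_le {C : ℝ} (hC : ∀ y, |deriv lineBump y| ≤ C) (j : ℕ) (i : Fin N)
    (hx : x ∈ cornerSpace N k) :
    |pderiv i (faceCut N k j) x| ≤ 2 * C * if i ∈ faceIdx N k then (x i)⁻¹ else 0 := by
  have hC0 : 0 ≤ C := (abs_nonneg _).trans (hC 0)
  rw [pderiv_faceCut]
  split_ifs with hi
  · have hp := pos_of_mem_faceIdx hi hx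
    have hj : (0 : ℝ) < j + 1 := by positivity
    have hprod := prod_faceFactor_mem ((faceIdx N k).erase i) j x
    rw [abs_mul, abs_of_nonneg hprod.1, abs_neg, abs_mul, abs_of_pos hj]
    refine (mul_le_of_le_one_right (by positivity) hprod.2).trans ?_
    by_cases h2 : 2 < |((j : ℝ) + 1) * x i|
    · rw [deriv_lineBump_eq_zero h2, abs_zero, zero_mul]; positivity
    · rw [not_lt, abs_of_pos (by positivity)] at h2
      calc |deriv lineBump ((j + 1) * x i)| * (j + 1) ≤ C * (2 * (x i)⁻¹) := by
            refine mul_le_mul (hC _) ?_ hj.le hC0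
            rw [← div_eq_mul_inv, le_div_iff₀ hp]
            exact h2
        _ = _ := by ring
  · simp

/-- The set that supports the cutoff. -/
def cutoffSupport (N k n j : ℕ) : Set (EucN N) :=
  {x | (∀ l ∈ faceIdx N k, 1 / ((j : ℝ) + 1) ≤ x l) ∧
    Real.exp (-(n + 1)) ≤ ‖x‖ ∧ ‖x‖ ≤ Real.exp (n + 1)}

theorem cutoffSupport_subset (N k n j : ℕ) :
    cutoffSupport N k n j ⊆ cornerSpace N k \ {0} := by
  rintro x ⟨h1, h2, -⟩
  refine ⟨fun i hi => lt_of_lt_of_le (by positivity) (h1 i (mem_faceIdx.mpr hi)), ?_⟩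
  have : 0 < ‖x‖ := (Real.exp_pos _).trans_le h2
  simpa using this

theorem isCompact_cutoffSupport (N k n j : ℕ) : IsCompact (cutoffSupport N k n j) := by
  refine (isCompact_closedBall (0 : EucN N) (Real.exp (n + 1))).of_isClosed_subset ?_
    fun x hx => by simpa using hx.2.2
  have : cutoffSupport N k n j = (⋂ l ∈ faceIdx N k, {x : EucN N | 1 / ((j : ℝ) + 1) ≤ x l}) ∩
      ({x | Real.exp (-(n + 1)) ≤ ‖x‖} ∩ {x | ‖x‖ ≤ Real.exp (n + 1)}) := by
    ext x; simp [cutoffSupport]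
  rw [this]
  refine (isClosed_biInter fun l _ => isClosed_le continuous_const
    (contDiff_coord (n := 0) l).continuous).inter
    ((isClosed_le continuous_const continuous_norm).inter
      (isClosed_le continuous_norm continuous_const))

theorem tsupport_cutoff_subset (N k n j : ℕ) :
    tsupport (cutoff N k n j) ⊆ cutoffSupport N k n j := by
  refine closure_minimal (fun x hx => ?_) (isCompact_cutoffSupport N k n j).isClosed
  have hxU : x ∈ cornerSpace N k \ {0} := Set.mem_of_indicator_ne_zero hx
  have hx' : radCut n x * faceCut N k j x ≠ 0 := by
    rwa [Function.mem_support, cutoff, Set.indicator_of_mem hxU] at hx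
  refine ⟨fun l hl => ?_, exp_le_norm_of_radCut hxU.2 ?_⟩
  · by_contra hcon
    refine (right_ne_zero_of_mul hx') (Finset.prod_eq_zero hl ?_)
    have hp := pos_of_mem_faceIdx hl hxU.1
    rw [lineBump_eq_one, sub_self]
    rw [abs_of_pos (by positivity)]
    rw [not_le, lt_div_iff₀ (by positivity)] at hcon
    linarith
  · by_contra hcon
    exact (left_ne_zero_of_mul hx') (lineBump_eq_zero (not_le.mp hcon).le)

theorem cutoff_eventuallyEq (n j : ℕ) (hx : x ∈ cornerSpace N k \ {0}) :
    cutoff N k n j =ᶠ[𝓝 x] fun y => radCut n y * faceCut N k j y := by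
  filter_upwards [(isOpen_punctured N k).mem_nhds hx] with y hy
  simp only [cutoff, Set.indicator_of_mem hy]

theorem contDiff_cutoff (N k n j : ℕ) : ContDiff ℝ ∞ (cutoff N k n j) :=
  contDiff_of_contDiffAt_tsupport fun x hx => by
    have hxU := cutoffSupport_subset N k n j (tsupport_cutoff_subset N k n j hx)
    exact ((contDiffAt_radCut n hxU.2).mul (contDiff_faceCut j).contDiffAt).congr_of_eventuallyEq
      (cutoff_eventuallyEq n j hxU)

theorem pderiv_cutoff (n j : ℕ) (i : Fin N) (hx : x ∈ cornerSpace N k \ {0}) :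
    pderiv i (cutoff N k n j) x =
      pderiv i (radCut n) x * faceCut N k j x + radCut n x * pderiv i (faceCut N k j) x := by
  rw [(cutoff_eventuallyEq n j hx).pderiv_eq,
    pderiv_mul i ((contDiffAt_radCut n hx.2).differentiableAt (by simp))
      ((contDiff_faceCut j).differentiable (by simp) x)]

theorem isTestFun_alpha_mul_cutoff (N k : ℕ) (lam : ℝ) (n j : ℕ) :
    IsTestFun N k lam fun x => alphaFun N k lam x * cutoff N k n j x := by
  have hs := (tsupport_cutoff_subset N k n j).trans (cutoffSupport_subset N k n j)
  have hc : HasCompactSupport (cutoff N k n j) :=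
    (isCompact_cutoffSupport N k n j).of_isClosed_subset (isClosed_tsupport _)
      (tsupport_cutoff_subset N k n j)
  exact isTestFun_of_supp N k lam _
    (contDiff_mul_of_tsupport (fun x hx => contDiffAt_alphaFun hx) (contDiff_cutoff N k n j) hs)
    hc.mul_left (tsupport_mul_subset_right.trans hs)

theorem twistedGrad_alpha_mul_cutoff (n j : ℕ) (i : Fin N) (hx : x ∈ cornerSpace N k \ {0}) :
    twistedGrad N k lam i (fun x => alphaFun N k lam x * cutoff N k n j x) x =
      alphaFun N k lam x * pderiv i (cutoff N k n j) x := by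
  rw [twistedGrad, pderiv_mul i ((contDiffAt_alphaFun hx).differentiableAt (by simp))
    ((contDiff_cutoff N k n j).differentiable (by simp) x), pderiv_alphaFun i hx]
  ring

end Cutoff

/-! ### Radial weights and integrability of the ground state. -/

/-- A radial majorant of the square of the ground state. -/
def radWeight (N k : ℕ) (lam r : ℝ) : ℝ :=
  Real.exp (-(1 / 4) * r ^ 2) * r ^ (2 * mLam N k lam - ((N : ℝ) - 2))

/-- The critical weight `|x|⁻ᴺ` on an annulus. -/
def annulusWeight (N n : ℕ) : ℝ → ℝ :=
  (Set.Icc (Real.exp (-((n : ℝ) + 1))) 1).indicator fun y => (y ^ N)⁻¹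

section Weights

variable {N k : ℕ} {lam : ℝ} {x : EucN N}

theorem prod_coord_le (S : Finset (Fin N)) (hS : S ⊆ faceIdx N k) (hx : x ∈ cornerSpace N k) :
    0 ≤ ∏ l ∈ S, x l ∧ ∏ l ∈ S, x l ≤ ‖x‖ ^ S.card := by
  have hp : ∀ l ∈ S, 0 ≤ x l := fun l hl => (pos_of_mem_faceIdx (hS hl) hx).le
  refine ⟨Finset.prod_nonneg hp, ?_⟩
  rw [← Finset.prod_const]
  exact Finset.prod_le_prod hp fun l _ => (le_abs_self _).trans (abs_coord_le_norm x l)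

theorem alphaFun_eq_mul_prod (x : EucN N) : alphaFun N k lam x =
    Real.exp (-‖x‖ ^ 2 / 8) * ‖x‖ ^ (mLam N k lam - ((N : ℝ) - 2) / 2) *
      ((∏ i ∈ faceIdx N k, x i) / ‖x‖ ^ k) := rfl

/-- Used with B = 1 for α and with B = 1/|x| for α/x_i, where q is the remaining product of
coordinates over |x|^k. -/
theorem sq_mul_le_radWeight (hx : x ≠ 0) {q B : ℝ} (hq : 0 ≤ q) (hB : q ≤ B) :
    (Real.exp (-‖x‖ ^ 2 / 8) * ‖x‖ ^ (mLam N k lam - ((N : ℝ) - 2) / 2) * q) ^ 2 ≤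
      radWeight N k lam ‖x‖ * B ^ 2 := by
  have hr : 0 < ‖x‖ := norm_pos_iff.mpr hx
  have e1 : Real.exp (-‖x‖ ^ 2 / 8) ^ 2 = Real.exp (-(1 / 4) * ‖x‖ ^ 2) := by
    rw [← Real.exp_nat_mul]; congr 1; push_cast; ring
  have e2 : (‖x‖ ^ (mLam N k lam - ((N : ℝ) - 2) / 2)) ^ 2 =
      ‖x‖ ^ (2 * mLam N k lam - ((N : ℝ) - 2)) := by
    rw [← Real.rpow_natCast, ← Real.rpow_mul hr.le]; congr 1; push_cast; ring
  rw [mul_pow, mul_pow, e1, e2, radWeight]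
  gcongr

theorem alphaFun_sq_le (hk : k ≤ N) (hx : x ∈ cornerSpace N k \ {0}) :
    alphaFun N k lam x ^ 2 ≤ radWeight N k lam ‖x‖ := by
  have hr : 0 < ‖x‖ := norm_pos_iff.mpr hx.2
  have h := prod_coord_le (faceIdx N k) subset_rfl hx.1
  rw [card_faceIdx hk] at h
  rw [alphaFun_eq_mul_prod]
  refine (sq_mul_le_radWeight hx.2 (B := 1) (div_nonneg h.1 (by positivity)) ?_).trans (by simp)
  exact div_le_one_of_le₀ h.2 (by positivity)

theorem alphaFun_div_coord_sq_le (hk : k ≤ N) (hx : x ∈ cornerSpace N k \ {0}) {i : Fin N}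
    (hi : i ∈ faceIdx N k) :
    (alphaFun N k lam x * (x i)⁻¹) ^ 2 ≤ radWeight N k lam ‖x‖ * (‖x‖⁻¹) ^ 2 := by
  have hr : 0 < ‖x‖ := norm_pos_iff.mpr hx.2
  have hp := (pos_of_mem_faceIdx hi hx.1).ne'
  have h := prod_coord_le ((faceIdx N k).erase i) (Finset.erase_subset _ _) hx.1
  have hcard : ((faceIdx N k).erase i).card + 1 = k := by
    rw [Finset.card_erase_add_one hi, card_faceIdx hk]
  have e : alphaFun N k lam x * (x i)⁻¹ =
      Real.exp (-‖x‖ ^ 2 / 8) * ‖x‖ ^ (mLam N k lam - ((N : ℝ) - 2) / 2) *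
        ((∏ l ∈ (faceIdx N k).erase i, x l) / ‖x‖ ^ k) := by
    rw [alphaFun_eq_mul_prod, ← Finset.mul_prod_erase _ _ hi]
    field_simp
  rw [e]
  refine sq_mul_le_radWeight hx.2 (div_nonneg h.1 (by positivity)) ?_
  have e2 : ‖x‖ ^ k = ‖x‖ ^ ((faceIdx N k).erase i).card * ‖x‖ := by rw [← pow_succ, hcard]
  rw [div_le_iff₀ (by positivity), e2]
  refine h.2.trans (le_of_eq ?_)
  field_simp

theorem radWeight_nonneg {r : ℝ} (hr : 0 ≤ r) : 0 ≤ radWeight N k lam r := by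
  unfold radWeight; positivity

theorem annulusWeight_nonneg (N n : ℕ) (r : ℝ) : 0 ≤ annulusWeight N n r := by
  refine Set.indicator_nonneg (fun y hy => ?_) r
  have : 0 < y := (Real.exp_pos _).trans_le hy.1
  positivity

/-- For r ≤ 1 the left side is at most r^(2m_λ-N) ≤ r^(-N), with m_λ = 0 the critical case; for r ≥
1 the factor r^(-2) is at most 1. -/
theorem radWeight_mul_le {n : ℕ} {r : ℝ} (hr : Real.exp (-((n : ℝ) + 1)) ≤ r) :
    radWeight N k lam r * r⁻¹ ^ 2 ≤ radWeight N k lam r + annulusWeight N n r := by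
  have hr0 : 0 < r := (Real.exp_pos _).trans_le hr
  have hW := radWeight_nonneg (N := N) (k := k) (lam := lam) hr0.le
  rcases le_total r 1 with h1 | h1
  · have h2 : annulusWeight N n r = (r ^ N)⁻¹ := by
      rw [annulusWeight, Set.indicator_of_mem (Set.mem_Icc.mpr ⟨hr, h1⟩)]
    rw [h2]
    have e : r ^ (2 * mLam N k lam - ((N : ℝ) - 2)) * r⁻¹ ^ 2 =
        r ^ (2 * mLam N k lam) * (r ^ N)⁻¹ := by
      rw [show 2 * mLam N k lam - ((N : ℝ) - 2) = 2 * mLam N k lam + (2 : ℕ) - (N : ℕ) by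
        push_cast; ring, Real.rpow_sub hr0, Real.rpow_add hr0, Real.rpow_natCast,
        Real.rpow_natCast]
      field_simp
    have h3 : radWeight N k lam r * r⁻¹ ^ 2 ≤ (r ^ N)⁻¹ := by
      rw [radWeight, mul_assoc, e]
      have h4 : Real.exp (-(1 / 4) * r ^ 2) ≤ 1 := Real.exp_le_one_iff.mpr (by nlinarith [sq_nonneg r])
      have h5 : r ^ (2 * mLam N k lam) ≤ 1 :=
        Real.rpow_le_one hr0.le h1 (mul_nonneg zero_le_two mLam_nonneg)
      calc _ ≤ 1 * (1 * (r ^ N)⁻¹) := by gcongr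
        _ = _ := by ring
    linarith
  · have h2 := annulusWeight_nonneg N n r
    have h3 : r⁻¹ ^ 2 ≤ 1 := pow_le_one₀ (by positivity) (inv_le_one_of_one_le₀ h1)
    nlinarith

/-- In polar coordinates the exponents combine to 2m_λ + 1 > -1, with a Gaussian factor at infinity.
-/
theorem integrable_radWeight (hN : 2 ≤ N) :
    Integrable (fun x : EucN N => radWeight N k lam ‖x‖) := by
  have : Nonempty (Fin N) := ⟨⟨0, by omega⟩⟩
  rw [integrable_fun_norm_addHaar (E := EucN N) volume (f := radWeight N k lam)]
  have hm := mLam_nonneg (N := N) (k := k) (lam := lam)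
  refine (integrableOn_rpow_mul_exp_neg_mul_sq (b := 1 / 4) (by norm_num)
    (s := 2 * mLam N k lam + 1) (by linarith)).congr_fun (fun y hy => ?_) measurableSet_Ioi
  have hy : 0 < y := hy
  have e : y ^ (N - 1) * y ^ (2 * mLam N k lam - ((N : ℝ) - 2)) = y ^ (2 * mLam N k lam + 1) := by
    rw [← Real.rpow_natCast, ← Real.rpow_add hy]
    congr 1
    rw [Nat.cast_sub (by omega)]
    push_cast
    ring
  simp only [finrank_euclideanSpace, Fintype.card_fin, smul_eq_mul, radWeight]
  rw [← e]
  ring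

theorem pow_smul_annulusWeight (hN : 2 ≤ N) (n : ℕ) (y : ℝ) :
    y ^ (N - 1) • annulusWeight N n y =
      (Set.Icc (Real.exp (-((n : ℝ) + 1))) 1).indicator (fun y => y⁻¹) y := by
  by_cases hy : y ∈ Set.Icc (Real.exp (-((n : ℝ) + 1))) 1
  · have h0 : 0 < y := (Real.exp_pos _).trans_le hy.1
    rw [annulusWeight, Set.indicator_of_mem hy, Set.indicator_of_mem hy, smul_eq_mul]
    obtain ⟨M, rfl⟩ : ∃ M, N = M + 1 := ⟨N - 1, by omega⟩
    simp only [Nat.add_sub_cancel, pow_succ]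
    field_simp
  · rw [annulusWeight, Set.indicator_of_notMem hy, Set.indicator_of_notMem hy, smul_zero]

theorem integrable_annulusWeight (hN : 2 ≤ N) (n : ℕ) :
    Integrable (fun x : EucN N => annulusWeight N n ‖x‖) := by
  have : Nonempty (Fin N) := ⟨⟨0, by omega⟩⟩
  rw [integrable_fun_norm_addHaar (E := EucN N) volume (f := annulusWeight N n)]
  simp only [finrank_euclideanSpace, Fintype.card_fin]
  simp_rw [pow_smul_annulusWeight hN]
  refine Integrable.integrableOn ?_
  rw [integrable_indicator_iff measurableSet_Icc]
  exact (continuousOn_inv₀.mono fun y hy =>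
    ((Real.exp_pos _).trans_le hy.1).ne').integrableOn_Icc

/-- In polar coordinates the integrand is dr/r over [e^(-(n+1)), 1]. Growth only linear in n is what
the logarithmic cutoff exploits. -/
theorem integral_annulusWeight (hN : 2 ≤ N) (n : ℕ) :
    ∫ x : EucN N, annulusWeight N n ‖x‖ =
      N * volume.real (Metric.ball (0 : EucN N) 1) * (n + 1) := by
  have : Nonempty (Fin N) := ⟨⟨0, by omega⟩⟩
  rw [integral_fun_norm_addHaar (E := EucN N) volume (annulusWeight N n)]
  simp only [finrank_euclideanSpace, Fintype.card_fin]
  simp_rw [pow_smul_annulusWeight hN]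
  have hsub : Set.Icc (Real.exp (-((n : ℝ) + 1))) 1 ⊆ Set.Ioi 0 := fun y hy =>
    (Real.exp_pos _).trans_le hy.1
  have hle : Real.exp (-((n : ℝ) + 1)) ≤ 1 := Real.exp_le_one_iff.mpr (by linarith [n.cast_nonneg (α := ℝ)])
  rw [setIntegral_indicator measurableSet_Icc, Set.inter_eq_right.mpr hsub,
    integral_Icc_eq_integral_Ioc, ← intervalIntegral.integral_of_le hle,
    integral_inv_of_pos (Real.exp_pos _) one_pos, one_div, ← Real.exp_neg, Real.log_exp]
  simp
  ring

theorem measurable_alphaFun (N k : ℕ) (lam : ℝ) : Measurable (alphaFun N k lam) := by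
  have h : ∀ i : Fin N, Measurable fun x : EucN N => x i := fun i =>
    (contDiff_coord (n := 0) i).continuous.measurable
  unfold alphaFun
  refine Measurable.mul ?_ ((Finset.measurable_prod _ fun i _ => h i).div ?_)
  · exact (by fun_prop : Measurable fun x : EucN N => Real.exp (-‖x‖ ^ 2 / 8)).mul
      (measurable_norm.pow_const _)
  · exact measurable_norm.pow_const _

theorem alphaFun_memLp (hN : 2 ≤ N) (hk : k ≤ N) :
    MemLp (alphaFun N k lam) 2 (cornerMeasure N k) := by
  have : Nonempty (Fin N) := ⟨⟨0, by omega⟩⟩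
  rw [memLp_two_iff_integrable_sq (measurable_alphaFun N k lam).aestronglyMeasurable]
  refine ((integrable_radWeight (k := k) (lam := lam) hN).restrict (s := cornerSpace N k)).mono'
    ((measurable_alphaFun N k lam).pow_const 2).aestronglyMeasurable ?_
  filter_upwards [ae_corner_mem N k] with x hx
  rw [Real.norm_eq_abs, abs_of_nonneg (sq_nonneg _)]
  exact alphaFun_sq_le hk hx

end Weights

/-! ### The ground state as a limit of test functions. -/

section Approximation

variable {N k : ℕ} {lam : ℝ} {x : EucN N}

/-- The integrable majorant of the square of `α` times the gradient of the cutoff. -/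
def cutoffMajorant (N k : ℕ) (lam : ℝ) (n : ℕ) (x : EucN N) : ℝ :=
  radWeight N k lam ‖x‖ + annulusWeight N n ‖x‖

theorem cutoffMajorant_nonneg (n : ℕ) (x : EucN N) : 0 ≤ cutoffMajorant N k lam n x :=
  add_nonneg (radWeight_nonneg (norm_nonneg x)) (annulusWeight_nonneg N n _)

theorem integrable_cutoffMajorant (hN : 2 ≤ N) (n : ℕ) :
    Integrable (cutoffMajorant N k lam n) :=
  (integrable_radWeight hN).add (integrable_annulusWeight hN n)

theorem alpha_mul_pderiv_radCut_sq_le (hk : k ≤ N) {C : ℝ} (hC : ∀ y, |deriv lineBump y| ≤ C)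
    (n : ℕ) (i : Fin N) (hx : x ∈ cornerSpace N k \ {0}) :
    (alphaFun N k lam x * pderiv i (radCut n) x) ^ 2 ≤
      (2 * C / (n + 1)) ^ 2 * cutoffMajorant N k lam n x := by
  have hC0 : 0 ≤ C := (abs_nonneg _).trans (hC 0)
  by_cases h : |Real.log (‖x‖ ^ 2) / (n + 1)| ≤ 2
  · have h1 := radWeight_mul_le (N := N) (k := k) (lam := lam) (exp_le_norm_of_radCut hx.2 h).1
    have h2 : (pderiv i (radCut n) x) ^ 2 ≤ (2 * C / (n + 1) * ‖x‖⁻¹) ^ 2 := by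
      rw [← sq_abs]
      exact pow_le_pow_left₀ (abs_nonneg _) (abs_pderiv_radCut_le hC n i hx.2) 2
    calc _ = alphaFun N k lam x ^ 2 * pderiv i (radCut n) x ^ 2 := mul_pow _ _ _
      _ ≤ radWeight N k lam ‖x‖ * (2 * C / (n + 1) * ‖x‖⁻¹) ^ 2 :=
          mul_le_mul (alphaFun_sq_le hk hx) h2 (sq_nonneg _) (radWeight_nonneg (norm_nonneg x))
      _ = (2 * C / (n + 1)) ^ 2 * (radWeight N k lam ‖x‖ * ‖x‖⁻¹ ^ 2) := by ring
      _ ≤ _ := mul_le_mul_of_nonneg_left h1 (sq_nonneg _)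
  · rw [pderiv_radCut n i hx.2, deriv_lineBump_eq_zero (not_le.mp h)]
    simp only [zero_mul, mul_zero, ne_eq, OfNat.ofNat_ne_zero, not_false_eq_true, zero_pow]
    exact mul_nonneg (sq_nonneg _) (cutoffMajorant_nonneg n x)

theorem alpha_mul_radCut_mul_pderiv_faceCut_sq_le (hk : k ≤ N) {C : ℝ}
    (hC : ∀ y, |deriv lineBump y| ≤ C) (n j : ℕ) (i : Fin N)
    (hx : x ∈ cornerSpace N k \ {0}) :
    (alphaFun N k lam x * (radCut n x * pderiv i (faceCut N k j) x)) ^ 2 ≤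
      (2 * C) ^ 2 * cutoffMajorant N k lam n x := by
  have hM := mul_nonneg (sq_nonneg (2 * C)) (cutoffMajorant_nonneg (k := k) (lam := lam) n x)
  have hb := abs_pderiv_faceCut_le hC j i hx.1
  by_cases hi : i ∈ faceIdx N k
  swap
  · rw [pderiv_faceCut, if_neg hi]
    simpa using hM
  rw [if_pos hi] at hb
  by_cases h : |Real.log (‖x‖ ^ 2) / (n + 1)| ≤ 2
  · have h1 := radWeight_mul_le (N := N) (k := k) (lam := lam) (exp_le_norm_of_radCut hx.2 h).1
    have h2 : (radCut n x * pderiv i (faceCut N k j) x) ^ 2 ≤ (2 * C * (x i)⁻¹) ^ 2 := by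
      rw [← sq_abs, abs_mul, abs_of_nonneg (radCut_mem n x).1]
      refine pow_le_pow_left₀ (mul_nonneg (radCut_mem n x).1 (abs_nonneg _)) ?_ 2
      exact (mul_le_of_le_one_left (abs_nonneg _) (radCut_mem n x).2).trans hb
    calc _ = alphaFun N k lam x ^ 2 * (radCut n x * pderiv i (faceCut N k j) x) ^ 2 :=
          mul_pow _ _ _
      _ ≤ alphaFun N k lam x ^ 2 * (2 * C * (x i)⁻¹) ^ 2 := by gcongr
      _ = (2 * C) ^ 2 * (alphaFun N k lam x * (x i)⁻¹) ^ 2 := by ring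
      _ ≤ _ := by
          gcongr
          exact (alphaFun_div_coord_sq_le hk hx hi).trans h1
  · have : radCut n x = 0 := lineBump_eq_zero (not_le.mp h).le
    simpa [this] using hM

/-- The product rule gives two terms whose squares are each at most 4C² times the majorant, and
(a+b)² ≤ 2(a²+b²) makes the constant 16C². The majorant does not depend on j. -/
theorem alpha_mul_pderiv_cutoff_sq_le (hk : k ≤ N) {C : ℝ}
    (hC : ∀ y, |deriv lineBump y| ≤ C) (n j : ℕ) (i : Fin N)
    (hx : x ∈ cornerSpace N k \ {0}) :
    (alphaFun N k lam x * pderiv i (cutoff N k n j) x) ^ 2 ≤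
      16 * C ^ 2 * cutoffMajorant N k lam n x := by
  have hM := cutoffMajorant_nonneg (k := k) (lam := lam) n x
  have h1 := alpha_mul_pderiv_radCut_sq_le (lam := lam) hk hC n i hx
  have h2 := alpha_mul_radCut_mul_pderiv_faceCut_sq_le (lam := lam) hk hC n j i hx
  have hC0 : 0 ≤ C := (abs_nonneg _).trans (hC 0)
  have h3 : (2 * C / ((n : ℝ) + 1)) ^ 2 ≤ (2 * C) ^ 2 := by
    refine pow_le_pow_left₀ (by positivity) (div_le_self (by positivity) ?_) 2
    linarith [n.cast_nonneg (α := ℝ)]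
  have h4 : (alphaFun N k lam x * pderiv i (radCut n) x * faceCut N k j x) ^ 2 ≤
      (alphaFun N k lam x * pderiv i (radCut n) x) ^ 2 := by
    rw [mul_pow]
    exact mul_le_of_le_one_right (sq_nonneg _)
      (pow_le_one₀ (faceCut_mem j x).1 (faceCut_mem j x).2)
  have h5 := h1.trans (mul_le_mul_of_nonneg_right h3 hM)
  rw [pderiv_cutoff n j i hx, mul_add, ← mul_assoc (alphaFun N k lam x)]
  refine (add_sq_le).trans ?_
  linarith

theorem tendsto_integral_alpha_cutoff_sub (hN : 2 ≤ N) (hk : k ≤ N) (n : ℕ) :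
    Tendsto (fun j => ∫ x, (alphaFun N k lam x * cutoff N k n j x - alphaFun N k lam x) ^ 2
      ∂(cornerMeasure N k)) atTop
      (𝓝 (∫ x, (alphaFun N k lam x * radCut n x - alphaFun N k lam x) ^ 2
        ∂(cornerMeasure N k))) := by
  have : Nonempty (Fin N) := ⟨⟨0, by omega⟩⟩
  have hα := alphaFun_memLp (lam := lam) hN hk
  refine tendsto_integral_of_dominated_convergence (fun x => alphaFun N k lam x ^ 2)
    (fun j => ?_) hα.integrable_sq (fun j => ?_) ?_
  · exact ((hα.1.mul (contDiff_cutoff N k n j).continuous.aestronglyMeasurable).sub hα.1).pow 2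
  · filter_upwards [ae_corner_mem N k] with x hx
    rw [cutoff, Set.indicator_of_mem hx, Real.norm_eq_abs, abs_of_nonneg (sq_nonneg _),
      show ∀ a b : ℝ, (a * b - a) ^ 2 = a ^ 2 * (1 - b) ^ 2 from fun a b => by ring]
    have h1 := radCut_mem n x
    have h2 := faceCut_mem (k := k) j x
    have h3 : radCut n x * faceCut N k j x ≤ 1 := mul_le_one₀ h1.2 h2.1 h2.2
    have h4 := mul_nonneg h1.1 h2.1
    exact mul_le_of_le_one_right (sq_nonneg _) (pow_le_one₀ (by linarith) (by linarith))
  · filter_upwards [ae_corner_mem N k] with x hx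
    refine tendsto_const_nhds.congr' ?_
    filter_upwards [eventually_faceCut hx.1] with j hj
    rw [cutoff, Set.indicator_of_mem hx, hj.1, mul_one]

theorem tendsto_integral_alpha_radCut_sub (hN : 2 ≤ N) (hk : k ≤ N) :
    Tendsto (fun n => ∫ x, (alphaFun N k lam x * radCut n x - alphaFun N k lam x) ^ 2
      ∂(cornerMeasure N k)) atTop (𝓝 0) := by
  have hα := alphaFun_memLp (lam := lam) hN hk
  rw [← integral_zero (EucN N) ℝ (μ := cornerMeasure N k)]
  refine tendsto_integral_of_dominated_convergence (fun x => alphaFun N k lam x ^ 2)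
    (fun n => ?_) hα.integrable_sq (fun n => ?_) ?_
  · have hm : Measurable (radCut (N := N) n) :=
      (contDiff_lineBump (n := 0)).continuous.measurable.comp
        ((Real.measurable_log.comp (measurable_norm.pow_const 2)).div_const _)
    exact ((hα.1.mul hm.aestronglyMeasurable).sub hα.1).pow 2
  · refine Eventually.of_forall fun x => ?_
    rw [Real.norm_eq_abs, abs_of_nonneg (sq_nonneg _),
      show ∀ a b : ℝ, (a * b - a) ^ 2 = a ^ 2 * (1 - b) ^ 2 from fun a b => by ring]
    have h1 := radCut_mem n x
    exact mul_le_of_le_one_right (sq_nonneg _) (pow_le_one₀ (by linarith) (by linarith))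
  · refine Eventually.of_forall fun x => tendsto_const_nhds.congr' ?_
    filter_upwards [eventually_radCut x] with n hn
    simp [hn]

/-- For fixed n the face cutoff is removed by dominated convergence: at each point it is eventually
1 with zero derivatives. -/
theorem tendsto_integral_alpha_pderiv_cutoff (hN : 2 ≤ N) (hk : k ≤ N) (n : ℕ) (i : Fin N) :
    Tendsto (fun j => ∫ x, (alphaFun N k lam x * pderiv i (cutoff N k n j) x) ^ 2
      ∂(cornerMeasure N k)) atTop
      (𝓝 (∫ x, (alphaFun N k lam x * pderiv i (radCut n) x) ^ 2 ∂(cornerMeasure N k))) := by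
  have : Nonempty (Fin N) := ⟨⟨0, by omega⟩⟩
  have hα := alphaFun_memLp (lam := lam) hN hk
  obtain ⟨C, -, hC⟩ := exists_deriv_lineBump_bound
  refine tendsto_integral_of_dominated_convergence
    (fun x => 16 * C ^ 2 * cutoffMajorant N k lam n x) (fun j => ?_)
    ((integrable_cutoffMajorant hN n).const_mul _).restrict (fun j => ?_) ?_
  · exact (hα.1.mul (((contDiff_cutoff N k n j).pderiv_smooth i).continuous
      ).aestronglyMeasurable).pow 2
  · filter_upwards [ae_corner_mem N k] with x hx
    rw [Real.norm_eq_abs, abs_of_nonneg (sq_nonneg _)]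
    exact alpha_mul_pderiv_cutoff_sq_le hk hC n j i hx
  · filter_upwards [ae_corner_mem N k] with x hx
    refine tendsto_const_nhds.congr' ?_
    filter_upwards [eventually_faceCut hx.1] with j hj
    rw [pderiv_cutoff n j i hx, hj.1, hj.2 i]
    simp

/-- The integral is at most (2C/(n+1))²(a + b(n+1)): the squared gradient of the cutoff gains
(n+1)^(-2), while the critical weight costs only a factor n+1. -/
theorem tendsto_integral_alpha_pderiv_radCut (hN : 2 ≤ N) (hk : k ≤ N) (i : Fin N) :
    Tendsto (fun n => ∫ x, (alphaFun N k lam x * pderiv i (radCut n) x) ^ 2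
      ∂(cornerMeasure N k)) atTop (𝓝 0) := by
  have : Nonempty (Fin N) := ⟨⟨0, by omega⟩⟩
  obtain ⟨C, -, hC⟩ := exists_deriv_lineBump_bound
  set a := ∫ x : EucN N, radWeight N k lam ‖x‖
  set b := (N : ℝ) * volume.real (Metric.ball (0 : EucN N) 1)
  have hbound : ∀ n : ℕ, ∫ x, (alphaFun N k lam x * pderiv i (radCut n) x) ^ 2
      ∂(cornerMeasure N k) ≤ (2 * C / (n + 1)) ^ 2 * (a + b * (n + 1)) := by
    intro n
    have hint := (integrable_cutoffMajorant (k := k) (lam := lam) hN n).const_mul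
      ((2 * C / ((n : ℝ) + 1)) ^ 2)
    calc _ ≤ ∫ x, (2 * C / (n + 1)) ^ 2 * cutoffMajorant N k lam n x ∂(cornerMeasure N k) := by
          refine integral_mono_of_nonneg (Eventually.of_forall fun x => sq_nonneg _)
            hint.restrict ?_
          filter_upwards [ae_corner_mem N k] with x hx
          exact alpha_mul_pderiv_radCut_sq_le hk hC n i hx
      _ ≤ ∫ x, (2 * C / (n + 1)) ^ 2 * cutoffMajorant N k lam n x :=
          setIntegral_le_integral hint (Eventually.of_forall fun x =>
            mul_nonneg (sq_nonneg _) (cutoffMajorant_nonneg n x))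
      _ = _ := by
          rw [integral_const_mul]
          congr 1
          unfold cutoffMajorant
          rw [integral_add (integrable_radWeight hN) (integrable_annulusWeight hN n),
            integral_annulusWeight hN n]
  refine squeeze_zero (fun n => integral_nonneg fun x => sq_nonneg _) hbound ?_
  have h1 := tendsto_one_div_add_atTop_nhds_zero_nat (𝕜 := ℝ)
  have h2 := ((h1.pow 2).const_mul (4 * C ^ 2 * a)).add (h1.const_mul (4 * C ^ 2 * b))
  simp only [ne_eq, OfNat.ofNat_ne_zero, not_false_eq_true, zero_pow, mul_zero, add_zero] at h2
  refine h2.congr fun n => ?_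
  have : (n : ℝ) + 1 ≠ 0 := by positivity
  field_simp
  ring

theorem exists_cutoff_lt (hN : 2 ≤ N) (hk : k ≤ N) {ε : ℝ} (hε : 0 < ε) : ∃ n j : ℕ,
    ∫ x, (alphaFun N k lam x * cutoff N k n j x - alphaFun N k lam x) ^ 2
      ∂(cornerMeasure N k) < ε ∧
    ∀ i, ∫ x, (alphaFun N k lam x * pderiv i (cutoff N k n j) x) ^ 2
      ∂(cornerMeasure N k) < ε := by
  -- The order of choice matters: n comes first, from the purely radial limits, then j depending on
  -- n, since the majorant for the limit in j depends on n.
  obtain ⟨n, h1, h2⟩ := (((tendsto_integral_alpha_radCut_sub (lam := lam) hN hk).eventually_lt_const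
    hε).and (eventually_all.mpr fun i =>
      (tendsto_integral_alpha_pderiv_radCut (lam := lam) hN hk i).eventually_lt_const hε)).exists
  obtain ⟨j, h3, h4⟩ := (((tendsto_integral_alpha_cutoff_sub (lam := lam) hN hk n
    ).eventually_lt_const h1).and (eventually_all.mpr fun i =>
      (tendsto_integral_alpha_pderiv_cutoff (lam := lam) hN hk n i).eventually_lt_const
        (h2 i))).exists
  exact ⟨n, j, h3, h4⟩

theorem tendsto_of_norm_sq_lt {E : Type*} [NormedAddCommGroup E] {f : ℕ → E} {a : E}
    (h : ∀ m : ℕ, ‖f m - a‖ ^ 2 < 1 / ((m : ℝ) + 1)) : Tendsto f atTop (𝓝 a) := by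
  rw [tendsto_iff_norm_sub_tendsto_zero]
  have h1 := squeeze_zero (fun m => sq_nonneg ‖f m - a‖) (fun m => (h m).le)
    tendsto_one_div_add_atTop_nhds_zero_nat
  have h2 := h1.sqrt
  simpa [Real.sqrt_sq] using h2

theorem IsTestFun.const_smul {φ : EucN N → ℝ} (h : IsTestFun N k lam φ) (c : ℝ) :
    IsTestFun N k lam (c • φ) := by
  refine ⟨h.smooth.const_smul c, h.compact.smul_left (f := fun _ => c),
    (tsupport_smul_subset_right (fun _ => c) φ).trans h.supp, ?_⟩
  refine (h.finite.const_mul (c ^ 2)).congr (Eventually.of_forall fun x => ?_)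
  simp only [Pi.smul_apply, smul_eq_mul]
  ring

theorem twistedGrad_const_smul {φ : EucN N → ℝ} (h : IsTestFun N k lam φ) (c : ℝ) (i : Fin N) :
    twistedGrad N k lam i (c • φ) = c • twistedGrad N k lam i φ := by
  funext x
  have e : pderiv i (c • φ) x = c * pderiv i φ x := by
    rw [((h.differentiableAt x).hasFDerivAt.const_smul c).pderiv_eq]
    rfl
  simp only [twistedGrad, e, Pi.smul_apply, smul_eq_mul]
  ring

theorem smul_mem_formDomain (hN : 2 ≤ N) (hk : k ≤ N) (hlam : lam ≤ hardyConst N k)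
    {u : CornerL2 N k} (hu : u ∈ formDomain N k lam) (c : ℝ) : c • u ∈ formDomain N k lam := by
  obtain ⟨φ, hφ⟩ := hu
  obtain ⟨V, hV⟩ := hφ.exists_tendsto_twistedGrad hN hk hlam
  refine ⟨fun n => c • φ n, formApprox_of_tendsto hN hk hlam (V := fun i => c • V i)
    (fun n => (hφ.test n).const_smul c) ((tendsto_toLp_of_formApprox hφ).const_smul c)
    fun i => ((hV i).const_smul c).congr fun n => ?_⟩
  rw [← MemLp.toLp_const_smul]
  congr 1
  exact (twistedGrad_const_smul (hφ.test n) c i).symm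

/-- The ground state belongs to the form domain. -/
theorem alpha_mem_formDomain (hN : 2 ≤ N) (hk : k ≤ N) (hlam : lam ≤ hardyConst N k)
    (hα : MemLp (alphaFun N k lam) 2 (cornerMeasure N k)) :
    hα.toLp (alphaFun N k lam) ∈ formDomain N k lam := by
  have : Nonempty (Fin N) := ⟨⟨0, by omega⟩⟩
  choose n j h1 h2 using fun m : ℕ => exists_cutoff_lt (lam := lam) hN hk
    (Nat.one_div_pos_of_nat (α := ℝ) (n := m))
  have ht := fun m => isTestFun_alpha_mul_cutoff N k lam (n m) (j m)
  have hu : Tendsto (fun m => (ht m).memLp.toLp _) atTop (𝓝 (hα.toLp (alphaFun N k lam))) := by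
    refine tendsto_of_norm_sq_lt fun m => ?_
    rw [← MemLp.toLp_sub, norm_toLp_sq]
    exact h1 m
  -- Since D_i(αη) = α ∂_i η, the twisted gradients of the approximants tend to 0.
  have hV : ∀ i, Tendsto (fun m => ((ht m).twistedGrad_memLp hN i).toLp _) atTop (𝓝 0) := by
    refine fun i => tendsto_of_norm_sq_lt fun m => ?_
    rw [sub_zero, norm_toLp_sq]
    refine lt_of_eq_of_lt (integral_congr_ae ?_) (h2 m i)
    filter_upwards [ae_corner_mem N k] with x hx
    rw [twistedGrad_alpha_mul_cutoff _ _ i hx]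
  exact ⟨_, formApprox_of_tendsto hN hk hlam ht hu (V := fun _ => 0) hV⟩

theorem alpha_toLp_ne_zero (hN : 2 ≤ N) (hα : MemLp (alphaFun N k lam) 2 (cornerMeasure N k)) :
    hα.toLp (alphaFun N k lam) ≠ 0 := by
  have : Nonempty (Fin N) := ⟨⟨0, by omega⟩⟩
  intro h
  have h1 := hα.coeFn_toLp
  rw [h] at h1
  have h2 : ∀ᵐ x ∂(cornerMeasure N k), False := by
    filter_upwards [h1, Lp.coeFn_zero ℝ 2 (cornerMeasure N k), ae_corner_mem N k] with x e1 e2 hx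
    exact (alphaFun_pos hx).ne' (e1.symm.trans e2)
  rw [eventually_false_iff_eq_bot, ae_eq_bot, cornerMeasure, Measure.restrict_eq_zero] at h2
  refine ((isOpen_cornerSpace N k).measure_pos volume ⟨WithLp.toLp 2 fun _ => 1, ?_⟩).ne' h2
  intro i _
  simp

end Approximation

end

/-! ### The lowest eigenvalue and its eigenspace. -/

theorem mainTheorem3 (N k : ℕ) (hN : 2 ≤ N) (hk : k ≤ N) (lam : ℝ)
    (hlam : lam ≤ hardyConst N k) :
    IsLeast (eigenvaluesL N k lam) ((1 + mLam N k lam) / 2) ∧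
    ∃ hα : MemLp (alphaFun N k lam) 2 (cornerMeasure N k),
      hα.toLp (alphaFun N k lam) ≠ 0 ∧
      hα.toLp (alphaFun N k lam) ∈ formDomain N k lam ∧
      hα.toLp (alphaFun N k lam) ∈ opDomain N k lam ∧
      eigenspaceL N k lam ((1 + mLam N k lam) / 2) =
        (Submodule.span ℝ {hα.toLp (alphaFun N k lam)} : Set (CornerL2 N k)) := by
  have hα := alphaFun_memLp (lam := lam) hN hk
  have hne := alpha_toLp_ne_zero hN hα
  have hdom := alpha_mem_formDomain hN hk hlam hα
  have hrep : ∀ c : ℝ, IsRepresentedBy N k lam (c • hα.toLp (alphaFun N k lam))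
      (groundEnergy N k lam • c • hα.toLp (alphaFun N k lam)) := fun c =>
    (twistedGradZero_smul_alpha hN hα c).isRepresentedBy hN hk hlam
      (smul_mem_formDomain hN hk hlam hdom c)
  have hrep1 := hrep 1
  rw [one_smul] at hrep1
  refine ⟨⟨⟨_, (mem_eigenspaceL_iff hN).mpr hrep1, hne⟩, ?_⟩, hα, hne, hdom, ⟨_, hrep1⟩, ?_⟩
  · rintro c ⟨u, hu, hu0⟩
    exact ((mem_eigenspaceL_iff hN).mp hu).groundEnergy_le hN hk hlam hu0
  · ext u
    rw [mem_eigenspaceL_iff hN, SetLike.mem_coe, Submodule.mem_span_singleton]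
    constructor
    · intro hu
      obtain ⟨c, hc⟩ := (IsRepresentedBy.twistedGradZero hN hk hlam hu).eq_smul_alpha hN hα
      exact ⟨c, hc.symm⟩
    · rintro ⟨c, rfl⟩
      exact hrep c
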